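/- For $n\ge 1$, a function $f:[-1,1]^n\to\mathbb{C}$ and $\omega\in\mathbb{R}$ put \[ I_n[f](\omega)=\frac1{n!}\int_{[-1,1]^n} f(x_0,\dots,x_{n-1})\prod_{0\le k<\ell\le n-1}(x_\ell-x_k)^2\,e^{i\omega(x_0+\cdots+x_{n-1})}\,dx_0\cdots dx_{n-1}. \] Let $\mathcal V_{n,r}$ be the set of vertices of $[-1,1]^n$ with exactly $r$ coordinates equal to $-1$, and let $\mathrm{SF}(m)=\prod_{i=1}^m i!$ (so $\mathrm{SF}(-1)=\mathrm{SF}(0)=1$). Let $\mu_k(\omega)=\int_{-1}^1x^ke^{i\omega x}\,dx$ and $h_n(\omega)=\det(\mu_{i+j}(\omega))_{0\le i,j\le n}$. Let $N\ge 0$ be an integer. All $\mathcal O$-terms refer to $\omega\to+\infty$, with $N$ and $f$ fixed. (1) Let $f$ be a smooth function on $[-1,1]^{2N+1}$ that is symmetric in its arguments, and let $v_1\in\mathcal V_{2N+1,N}$, $v_2\in\mathcal V_{2N+1,N+1}$ be such that $f(v_1)\ne0$ and $f(v_2)\ne0$. Then \[ I_{2N+1}[f](\omega)=-\frac{i(-1)^N}{\omega^{2N(N+1)+1}}\,4^{N(N+1)}\,\mathrm{SF}(N-1)^2\,\mathrm{SF}(N)^2\left[e^{i\omega}f(v_1)-e^{-i\omega}f(v_2)\right]+\mathcal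 O\!\left(\omega^{-2N(N+1)-2}\right). \] (2) If in addition $f$ is even, i.e. $f(-x)=f(x)$ on $[-1,1]^{2N+1}$, then \[ I_{2N+1}[f](\omega)=\frac{2(-1)^N}{\omega^{2N(N+1)+1}}\,4^{N(N+1)}\,\mathrm{SF}(N-1)^2\,\mathrm{SF}(N)^2\,f(v_1)\sin\omega+\mathcal O\!\left(\omega^{-2N(N+1)-2}\right). \] (3) Consequently \[ h_{2N}(\omega)=\frac{2(-1)^N}{\omega^{2N(N+1)+1}}\,4^{N(N+1)}\,\mathrm{SF}(N-1)^2\,\mathrm{SF}(N)^2\sin\omega+\mathcal O\!\left(\omega^{-2N(N+1)-2}\right), \] and $h_{2N}$ vanishes approximately at the multiples of $\pi$, where the polynomial of degree $2N+1$ fails to exist: there are constants $C,\Omega>0$, depending only on $N$, such that (a) for every integer $k\ge 0$ with $k\ge\Omega$ there is a real $\omega$ with $|\omega-k\pi|\le C/k$ and $h_{2N}(\omega)=0$, at which there is no monic polynomial $p$ of degree $2N+1$ with $\int_{-1}^1p(x)x^je^{i\omega x}\,dx=0$ for $j=0,\dots,2N$; (b) every $\omega\ge\Omega$ with $h_{2N}(\omega)=0$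 satisfies $|\omega-k\pi|\le C/\omega$ for some integer $k\ge0$, and for such $\omega$, too, there is no monic polynomial $p$ as in (a). -/

import Mathlib

open scoped BigOperators
open Asymptotics

noncomputable section

namespace Kissing

/-- The cube `[-1,1]^n`. -/
def cube (n : ℕ) : Set (Fin n → ℝ) := {x | ∀ i, x i ∈ Set.Icc (-1 : ℝ) 1}

/-- The Vandermonde product `g(x) = ∏_{k < l} (x_l - x_k)`. -/
def vandermondeProd {n : ℕ} (x : Fin n → ℝ) : ℝ :=
  ∏ k : Fin n, ∏ l ∈ Finset.Ioi k, (x l - x k)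

/-- `I_n[f](ω) = (1/n!) ∫_{[-1,1]^n} f(x) g(x)^2 e^{iω(x_0 + ... + x_{n-1})} dx`. -/
def symmIntegral (n : ℕ) (f : (Fin n → ℝ) → ℂ) (ω : ℝ) : ℂ :=
  (1 / (n.factorial : ℂ)) *
    ∫ x in cube n, f x * ((vandermondeProd x : ℝ) : ℂ) ^ 2 *
      Complex.exp (Complex.I * (ω : ℂ) * ((∑ j, x j : ℝ) : ℂ))

/-- `f` is invariant under permutations of its arguments, on the cube. -/
def IsSymmetricFun {n : ℕ} (f : (Fin n → ℝ) → ℂ) : Prop :=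
  ∀ σ : Equiv.Perm (Fin n), ∀ x ∈ cube n, f (fun i => x (σ i)) = f x

/-- `f(-x) = f(x)` on the cube. -/
def IsEvenFun {n : ℕ} (f : (Fin n → ℝ) → ℂ) : Prop :=
  ∀ x ∈ cube n, f (-x) = f x

/-- The vertices of the cube `[-1,1]^n` with exactly `r` coordinates equal to `-1`. -/
def vertices (n r : ℕ) : Set (Fin n → ℝ) :=
  {v | (∀ i, v i = 1 ∨ v i = -1) ∧ {i | v i = -1}.ncard = r}

/-- The moments `μ_k(ω) = ∫_{-1}^1 x^k e^{iωx} dx`. -/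
def moment (k : ℕ) (ω : ℝ) : ℂ :=
  ∫ x in (-1 : ℝ)..1, (x : ℂ) ^ k * Complex.exp (Complex.I * (ω : ℂ) * (x : ℂ))

/-- The Hankel determinant `h_n(ω) = det (μ_{i+j}(ω))_{0 ≤ i, j ≤ n}`, of size `n + 1`. -/
def hankelDet (n : ℕ) (ω : ℝ) : ℂ :=
  Matrix.det (Matrix.of fun i j : Fin (n + 1) => moment ((i : ℕ) + (j : ℕ)) ω)

/-- `p` is a monic polynomial of degree `n`, orthogonal to `1, x, ..., x^{n-1}` with respect to
the weight `e^{iωx}` on `[-1,1]`. -/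
def IsMonicOP (n : ℕ) (ω : ℝ) (p : Polynomial ℂ) : Prop :=
  p.Monic ∧ p.natDegree = n ∧
    ∀ k < n, ∫ x in (-1 : ℝ)..1,
      p.eval (x : ℂ) * (x : ℂ) ^ k * Complex.exp (Complex.I * (ω : ℂ) * (x : ℂ)) = 0

/-- The constant `4^{N(N+1)} SF(N-1)^2 SF(N)^2` with `SF(m) = ∏_{i=1}^m i!`. For `N = 0` the
truncated `N - 1 = 0` gives `SF(0) = 1`, which is also the empty product `SF(-1)`. -/
def oddConst (N : ℕ) : ℂ :=
  4 ^ (N * (N + 1)) * ((N - 1).superFactorial : ℂ) ^ 2 * (N.superFactorial : ℂ) ^ 2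

end Kissing

end

/-! Oscillatory integrals over `[-1,1]` localise at the endpoints: each integration by parts gains a
factor `1/ω`, and a boundary term survives only once the zero of the amplitude at that endpoint is
used up. Over the cube this localises `I_n[f]` at the vertices. The factor `∏ (x_l - x_k)^2`
vanishes to high order there, so the leading term is reached by rewriting that factor as products of
one-variable amplitudes.

For symmetric `f` one Vandermonde factor may be replaced by `n!` times the diagonal product of any
monic basis `φ_k`, and the other expanded over permutations (`symmIntegral_eq_sum`). With `φ_k =
(x-1)^⌈k/2⌉ (x+1)^⌊k/2⌋`, every permutation contributes at the same order `ω^{-leadExp n}`, so the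
coefficient of `f` at a vertex is a determinant `coefMatrix ε` (`isBigO_symmIntegral`). Most of
these determinants vanish: odd indices must carry the sign minus, and an even index followed by an
odd one must carry plus. Two vertices remain for `n = 2N+1` and one for `n = 2N+2`. On the
alternating vertex the matrix is block triangular with Hankel blocks of factorials, which gives the
superfactorials. The second coefficient for `n = 2N+1` follows from the first because `h_{2N}` is
real.

The function `f` is not a product, so it is expanded in a Chebyshev series. The coefficients decay
rapidly, since `f ∘ cos` is smooth and periodic, while the one-variable errors grow only
polynomially in the degree (`exists_bound_osc_endWeight_mul_T`). The asymptotics can therefore be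
summed term by term (`isBigO_integral_cube`).

Heine's formula gives `h_{2N}` by taking `f = 1`. Its normalisation is real, continuous and within
`O(1/ω)` of `sin ω`, which locates its large zeros. At such a zero a monic orthogonal polynomial of
degree `2N+1` would force `h_{2N+1} = 0` (`hankelDet_succ_eq_zero`), impossible for large `ω`
because a single vertex contributes to `h_{2N+1}` and nothing can cancel it. -/

namespace Kissing

/-! ### One-dimensional oscillatory integrals with Chebyshev amplitudes. -/

open Polynomial MeasureTheory

/-- The sign attached to a Boolean: `true ↦ 1`, `false ↦ -1`. -/
def sgn (s : Bool) : ℝ := cond s 1 (-1)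

@[simp] lemma sgn_true : sgn true = 1 := rfl
@[simp] lemma sgn_false : sgn false = -1 := rfl

lemma exists_bound_eval_of_abs_le_one (u : ℝ[X]) :
    ∃ C : ℝ, 0 ≤ C ∧ ∀ x : ℝ, |x| ≤ 1 → |u.eval x| ≤ C := by
  obtain ⟨C, hC⟩ := (isCompact_Icc (a := (-1 : ℝ)) (b := 1)).exists_bound_of_continuousOn
    u.continuous.continuousOn
  refine ⟨max C 0, le_max_right _ _, fun x hx => ?_⟩
  exact (hC x (abs_le.1 hx)).trans (le_max_left _ _)

/-- On `[-1,1]` the derivatives of `T_a` are bounded by their values at `1`, and `T_a^{(k)}(1) =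
∏_{l<k} (a² - l²)/(2l+1)`. The product is zero when `|a| < k`; otherwise each factor is at most
`(1+|a|)²`. -/
lemma abs_iterate_derivative_T_le (a : ℤ) (k : ℕ) {x : ℝ} (hx : |x| ≤ 1) :
    |(derivative^[k] (Chebyshev.T ℝ a)).eval x| ≤ (1 + |(a : ℝ)|) ^ (2 * k) := by
  refine (Chebyshev.abs_iterate_derivative_T_real_le a k hx).trans ?_
  refine (le_abs_self _).trans ?_
  have h := Chebyshev.iterate_derivative_T_eval_one (R := ℝ) a k
  have h1 : (1 : ℝ) ≤ |((∏ l ∈ Finset.range k, (2 * l + 1) : ℕ) : ℝ)| := by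
    rw [Nat.abs_cast]
    exact_mod_cast Nat.one_le_iff_ne_zero.2 (Finset.prod_ne_zero_iff.2 fun i _ => by lia)
  have h2 := congrArg abs h
  push_cast at h1 h2
  rw [abs_mul] at h2
  have h3 : |∏ l ∈ Finset.range k, ((a : ℝ) ^ 2 - (l : ℝ) ^ 2)| ≤ (1 + |(a : ℝ)|) ^ (2 * k) := by
    by_cases hk : a.natAbs < k
    · rw [Finset.prod_eq_zero (Finset.mem_range.2 hk)]
      · simp; positivity
      · rw [show ((a.natAbs : ℕ) : ℝ) = |(a : ℝ)| by simp [Nat.cast_natAbs], sq_abs, sub_self]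
    · rw [Finset.abs_prod, pow_mul]
      calc _ ≤ ∏ l ∈ Finset.range k, (1 + |(a : ℝ)|) ^ 2 := by
            refine Finset.prod_le_prod (fun _ _ => abs_nonneg _) fun l hl => ?_
            have hl' : (l : ℝ) ≤ |(a : ℝ)| := by
              have : l ≤ a.natAbs := by have := Finset.mem_range.1 hl; lia
              have h5 : ((l : ℤ) : ℝ) ≤ ((|a| : ℤ) : ℝ) := by
                rw [Int.abs_eq_natAbs]; exact_mod_cast this
              simpa using h5
            have h6 : (0 : ℝ) ≤ l := by positivity
            rw [abs_of_nonneg, ← sq_abs (a : ℝ)]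
            · nlinarith [abs_nonneg (a : ℝ)]
            · rw [← sq_abs (a : ℝ)]; nlinarith
        _ = _ := by simp
  calc _ ≤ _ := le_mul_of_one_le_left (abs_nonneg _) h1
    _ ≤ _ := by rw [h2]; exact h3

/-- Derivatives of `w * T_a` grow at most polynomially in `a`, uniformly on `[-1,1]`. -/
lemma exists_bound_iterate_derivative_mul_T (w : ℝ[X]) (j : ℕ) :
    ∃ C : ℝ, 0 ≤ C ∧ ∀ (a : ℤ) (x : ℝ), |x| ≤ 1 →
      |(derivative^[j] (w * Chebyshev.T ℝ a)).eval x| ≤ C * (1 + |(a : ℝ)|) ^ (2 * j) := by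
  choose D hD0 hD using fun i => exists_bound_eval_of_abs_le_one (derivative^[i] w)
  refine ⟨∑ k ∈ Finset.range j.succ, (j.choose k) * D (j - k),
    Finset.sum_nonneg fun i _ => mul_nonneg (by positivity) (hD0 _), fun a x hx => ?_⟩
  rw [iterate_derivative_mul, eval_finsetSum, Finset.sum_mul]
  refine (Finset.abs_sum_le_sum_abs _ _).trans (Finset.sum_le_sum fun k hk => ?_)
  rw [eval_smul, eval_mul, nsmul_eq_mul, abs_mul, abs_mul, Nat.abs_cast, mul_assoc]
  refine mul_le_mul_of_nonneg_left ?_ (by positivity)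
  refine mul_le_mul (hD _ x hx) ((abs_iterate_derivative_T_le a k hx).trans ?_) (abs_nonneg _)
    (hD0 _)
  exact pow_le_pow_right₀ (by linarith [abs_nonneg (a : ℝ)])
    (by have := Finset.mem_range.1 hk; lia)

/-- The oscillatory integral `∫_{-1}^1 u(x) e^{iωx} dx` of a real polynomial. -/
noncomputable def osc (u : ℝ[X]) (ω : ℝ) : ℂ :=
  ∫ x in (-1 : ℝ)..1, ((u.eval x : ℝ) : ℂ) * Complex.exp (Complex.I * (ω : ℂ) * (x : ℂ))

lemma norm_osc_le {u : ℝ[X]} {S : ℝ} (hS : ∀ x : ℝ, |x| ≤ 1 → |u.eval x| ≤ S) (ω : ℝ) :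
    ‖osc u ω‖ ≤ 2 * S := by
  have := intervalIntegral.norm_integral_le_of_norm_le_const (a := (-1 : ℝ)) (b := 1) (C := S)
    (f := fun x : ℝ => ((u.eval x : ℝ) : ℂ) * Complex.exp (Complex.I * (ω : ℂ) * (x : ℂ))) ?_
  · refine this.trans (le_of_eq ?_)
    norm_num [mul_comm]
  · intro x hx
    rw [Set.uIoc_of_le (by norm_num)] at hx
    have h1 : ‖Complex.exp (Complex.I * (ω : ℂ) * (x : ℂ))‖ = 1 := by
      rw [show Complex.I * (ω : ℂ) * (x : ℂ) = ((ω * x : ℝ) : ℂ) * Complex.I by push_cast; ring]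
      exact Complex.norm_exp_ofReal_mul_I _
    rw [norm_mul, h1, mul_one, Complex.norm_real]
    exact hS x (abs_le.2 ⟨hx.1.le, hx.2⟩)

/-- Boundary term of an integration by parts. -/
noncomputable def bdry (u : ℝ[X]) (ω : ℝ) : ℂ :=
  ((u.eval 1 : ℝ) : ℂ) * Complex.exp (Complex.I * ω) -
    ((u.eval (-1) : ℝ) : ℂ) * Complex.exp (-(Complex.I * ω))

lemma norm_bdry_le {u : ℝ[X]} {S : ℝ} (hS : ∀ x : ℝ, |x| ≤ 1 → |u.eval x| ≤ S) (ω : ℝ) :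
    ‖bdry u ω‖ ≤ 2 * S := by
  have h1 : ‖Complex.exp (Complex.I * (ω : ℂ))‖ = 1 := by
    rw [mul_comm]; exact Complex.norm_exp_ofReal_mul_I _
  have h2 : ‖Complex.exp (-(Complex.I * (ω : ℂ)))‖ = 1 := by
    rw [show -(Complex.I * (ω : ℂ)) = ((-ω : ℝ) : ℂ) * Complex.I by push_cast; ring]
    exact Complex.norm_exp_ofReal_mul_I _
  refine (norm_sub_le _ _).trans ?_
  rw [norm_mul, norm_mul, h1, h2, Complex.norm_real, Complex.norm_real, mul_one, mul_one]
  have := hS 1 (by norm_num)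
  have := hS (-1) (by norm_num)
  simp only [Real.norm_eq_abs]
  linarith

lemma osc_eq (u : ℝ[X]) {ω : ℝ} (hω : ω ≠ 0) :
    osc u ω = (Complex.I * ω)⁻¹ * (bdry u ω - osc (derivative u) ω) := by
  have hI : Complex.I * (ω : ℂ) ≠ 0 := by simp [hω]
  have hu : ∀ x : ℝ, HasDerivAt (fun x : ℝ => ((u.eval x : ℝ) : ℂ))
      (((derivative u).eval x : ℝ) : ℂ) x := fun x => (u.hasDerivAt x).ofReal_comp
  have hv : ∀ x : ℝ, HasDerivAt
      (fun x : ℝ => (Complex.I * ω)⁻¹ * Complex.exp (Complex.I * (ω : ℂ) * (x : ℂ)))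
      (Complex.exp (Complex.I * (ω : ℂ) * (x : ℂ))) x := by
    intro x
    have h1 : HasDerivAt (fun x : ℝ => Complex.I * (ω : ℂ) * (x : ℂ)) (Complex.I * (ω : ℂ) * 1) x :=
      (HasDerivAt.const_mul (Complex.I * (ω : ℂ)) Complex.ofRealCLM.hasDerivAt)
    have := (h1.cexp).const_mul (Complex.I * (ω : ℂ))⁻¹
    rwa [mul_one, mul_comm (Complex.exp _), inv_mul_cancel_left₀ hI] at this
  have key := intervalIntegral.integral_mul_deriv_eq_deriv_mul (a := -1) (b := 1)
    (fun x _ => hu x) (fun x _ => hv x)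
    (Continuous.intervalIntegrable (Complex.continuous_ofReal.comp (derivative u).continuous) _ _)
    (Continuous.intervalIntegrable (by fun_prop) _ _)
  rw [osc, key, osc, bdry]
  simp_rw [mul_left_comm _ (Complex.I * (ω : ℂ))⁻¹]
  rw [intervalIntegral.integral_const_mul]
  push_cast
  ring_nf

/-- The coefficient of `e^{iω} T(1)` (`s = true`) or `e^{-iω} T(-1)` (`s = false`) in the leading
term of `∫_{-1}^1 (x-1)^p (x+1)^q T(x) e^{iωx} dx`, of order `ω^{-(m+1)}`. -/
noncomputable def endCoef (p q m : ℕ) (s : Bool) : ℂ :=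
  cond s ((-1) ^ m / Complex.I ^ (m + 1) * if p = m then (m.factorial : ℂ) * 2 ^ q else 0)
    (-((-1) ^ m / Complex.I ^ (m + 1)) * if q = m then (m.factorial : ℂ) * (-2) ^ p else 0)

/-- The weight `(x-1)^p (x+1)^q`. -/
noncomputable def endWeight (p q : ℕ) : ℝ[X] := (X - C 1) ^ p * (X - C (-1)) ^ q

lemma eval_iterate_derivative_of_lt {r : ℝ} {k p : ℕ} (hk : k < p) (v : ℝ[X]) :
    (derivative^[k] ((X - C r) ^ p * v)).eval r = 0 := by
  have := Polynomial.aeval_iterate_derivative_of_lt (A := ℝ) ((X - C r) ^ p * v) p r (p' := v)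
    (by simp) hk
  simpa [aeval_def] using this

lemma eval_iterate_derivative_self {r : ℝ} {p : ℕ} (v : ℝ[X]) :
    (derivative^[p] ((X - C r) ^ p * v)).eval r = p.factorial * v.eval r := by
  have := Polynomial.aeval_iterate_derivative_self (A := ℝ) ((X - C r) ^ p * v) p r (p' := v)
    (by simp)
  simpa [aeval_def] using this

/-- Leading asymptotics of the oscillatory integral of `(x-1)^p (x+1)^q T_a(x)`, with an error
that is polynomially bounded in the degree `a`. -/
theorem exists_bound_osc_endWeight_mul_T {p q m : ℕ} (hp : m ≤ p) (hq : m ≤ q) :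
    ∃ D : ℝ, 0 ≤ D ∧ ∀ (a : ℤ) (ω : ℝ), 1 ≤ ω →
      ‖osc (endWeight p q * Chebyshev.T ℝ a) ω - ((ω : ℂ) ^ (m + 1))⁻¹ * ∑ s : Bool,
          endCoef p q m s * Complex.exp (Complex.I * ω * sgn s) *
            (((Chebyshev.T ℝ a).eval (sgn s) : ℝ) : ℂ)‖
        ≤ D * (1 + |(a : ℝ)|) ^ (2 * (m + 2)) * (ω ^ (m + 2))⁻¹ := by
  obtain ⟨D1, h10, h1⟩ := exists_bound_iterate_derivative_mul_T (endWeight p q) (m + 1)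
  obtain ⟨D2, h20, h2⟩ := exists_bound_iterate_derivative_mul_T (endWeight p q) (m + 2)
  refine ⟨2 * D1 + 2 * D2, by positivity, fun a ω hω => ?_⟩
  have hω0 : ω ≠ 0 := by positivity
  set u := endWeight p q * Chebyshev.T ℝ a with hu
  have hu1 : u = (X - C 1) ^ p * ((X - C (-1)) ^ q * Chebyshev.T ℝ a) := by
    rw [hu, endWeight, mul_assoc]
  have hu2 : u = (X - C (-1)) ^ q * ((X - C 1) ^ p * Chebyshev.T ℝ a) := by
    rw [hu, endWeight]; ring
  -- The zeros of order `p, q ≥ m` at the endpoints kill the first `m` boundary terms.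
  have hb : ∀ j < m, bdry (derivative^[j] u) ω = 0 := by
    intro j hj
    rw [bdry]
    nth_rewrite 1 [hu1]
    rw [hu2, eval_iterate_derivative_of_lt (hj.trans_le hp),
      eval_iterate_derivative_of_lt (hj.trans_le hq)]
    simp
  have hit : ∀ j ≤ m, osc u ω = (-(Complex.I * ω)⁻¹) ^ j * osc (derivative^[j] u) ω := by
    intro j
    induction j with
    | zero => intro _; simp
    | succ j ih =>
      intro hj
      rw [ih (by lia), osc_eq _ hω0, hb j (by lia), Function.iterate_succ_apply']
      ring
  have hm : bdry (derivative^[m] u) ω = ((if p = m then (m.factorial : ℂ) * 2 ^ q else 0) *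
      Complex.exp (Complex.I * ω) * (((Chebyshev.T ℝ a).eval 1 : ℝ) : ℂ)) -
      ((if q = m then (m.factorial : ℂ) * (-2) ^ p else 0) *
      Complex.exp (-(Complex.I * ω)) * (((Chebyshev.T ℝ a).eval (-1) : ℝ) : ℂ)) := by
    rw [bdry]
    nth_rewrite 1 [hu1]
    rw [hu2]
    congr 1
    · split_ifs with h
      · subst h
        rw [eval_iterate_derivative_self]
        norm_num
      · rw [eval_iterate_derivative_of_lt (by lia)]; simp
    · split_ifs with h
      · subst h
        rw [eval_iterate_derivative_self]
        norm_num
        ring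
      · rw [eval_iterate_derivative_of_lt (by lia)]; simp
  have hIω : Complex.I * (ω : ℂ) ≠ 0 := by simp [hω0]
  -- Two integrations by parts beyond the first `m`: the first yields the leading boundary term, the
  -- second makes the remainder visibly of order `ω^{-(m+2)}`.
  have hfin : osc u ω - ((ω : ℂ) ^ (m + 1))⁻¹ * ∑ s : Bool,
          endCoef p q m s * Complex.exp (Complex.I * ω * sgn s) *
            (((Chebyshev.T ℝ a).eval (sgn s) : ℝ) : ℂ) =
      (-(Complex.I * ω)⁻¹) ^ (m + 2) *
        (osc (derivative^[m+2] u) ω - bdry (derivative^[m+1] u) ω) := by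
    rw [hit m le_rfl, osc_eq _ hω0, ← Function.iterate_succ_apply' derivative, osc_eq _ hω0,
      ← Function.iterate_succ_apply' derivative, hm]
    simp only [Fintype.sum_bool, endCoef, cond_true, cond_false, sgn_true, sgn_false]
    simp only [Complex.ofReal_one, Complex.ofReal_neg, mul_one, mul_neg]
    have e1 : (-(Complex.I * (ω : ℂ))⁻¹) ^ m * (Complex.I * (ω : ℂ))⁻¹ =
        ((ω : ℂ) ^ (m + 1))⁻¹ * ((-1) ^ m / Complex.I ^ (m + 1)) := by
      rw [neg_pow, mul_assoc, ← pow_succ, inv_pow, mul_pow, mul_inv]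
      field_simp
    rw [← mul_assoc, e1, pow_add (-(Complex.I * (ω : ℂ))⁻¹) m 2, sq, ← mul_assoc, mul_neg, mul_neg,
      e1]
    simp only [Nat.succ_eq_add_one, add_assoc, one_add_one_eq_two]
    ring
  rw [hfin, norm_mul, norm_pow, norm_neg, norm_inv, norm_mul, Complex.norm_I, one_mul,
    Complex.norm_real, Real.norm_of_nonneg (by linarith), inv_pow, mul_comm]
  refine mul_le_mul_of_nonneg_right ?_ (by positivity)
  refine (norm_sub_le _ _).trans ?_
  have hA : (1 : ℝ) ≤ 1 + |(a : ℝ)| := by linarith [abs_nonneg (a : ℝ)]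
  have b1 := norm_bdry_le (fun x hx => (h1 a x hx).trans (mul_le_mul_of_nonneg_left
    (pow_le_pow_right₀ hA (show 2 * (m + 1) ≤ 2 * (m + 2) by lia)) h10)) ω
  have b2 := norm_osc_le (h2 a) ω
  linarith

end Kissing

/-! ### Rapid decay of Fourier coefficients of smooth periodic functions. -/

namespace Kissing

open Polynomial MeasureTheory

/-- Smooth functions on `ℝ^n` with period one in each variable. -/
structure SmoothPeriodic {n : ℕ} (g : (Fin n → ℝ) → ℂ) : Prop where
  contDiff : ContDiff ℝ ((⊤ : ℕ∞) : WithTop ℕ∞) g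
  periodic : ∀ x k, g (x + Pi.single k 1) = g x

/-- The exponential `e^{-2πi α·x}`. -/
noncomputable def negExp {n : ℕ} (α : Fin n → ℤ) (x : Fin n → ℝ) : ℂ :=
  Complex.exp (-(2 * Real.pi * Complex.I) * ∑ k, (α k : ℂ) * (x k : ℂ))

/-- Fourier coefficients over the unit box. -/
noncomputable def boxCoeff {n : ℕ} (g : (Fin n → ℝ) → ℂ) (α : Fin n → ℤ) : ℂ :=
  ∫ x in Set.Icc (0 : Fin n → ℝ) 1, negExp α x * g x

lemma continuous_negExp {n : ℕ} (α : Fin n → ℤ) : Continuous (negExp α) := by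
  unfold negExp; fun_prop

lemma norm_negExp {n : ℕ} (α : Fin n → ℤ) (x : Fin n → ℝ) : ‖negExp α x‖ = 1 := by
  rw [negExp, show -(2 * Real.pi * Complex.I) * ∑ k, (α k : ℂ) * (x k : ℂ) =
    ((-(2 * Real.pi) * ∑ k, (α k : ℝ) * x k : ℝ) : ℂ) * Complex.I by push_cast; ring]
  exact Complex.norm_exp_ofReal_mul_I _

lemma negExp_add_single {n : ℕ} (α : Fin n → ℤ) (x : Fin n → ℝ) (k : Fin n) :
    negExp α (x + Pi.single k 1) = negExp α x := by
  have h : ∑ j, (α j : ℂ) * (((x + Pi.single k (1 : ℝ) : Fin n → ℝ) j : ℝ) : ℂ) =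
      ∑ j, (α j : ℂ) * (x j : ℂ) + α k := by
    simp only [Pi.add_apply, Complex.ofReal_add, mul_add, Finset.sum_add_distrib, Pi.single_apply]
    simp [apply_ite (Complex.ofReal)]
  rw [negExp, h, negExp, mul_add, Complex.exp_add]
  have : Complex.exp (-(2 * Real.pi * Complex.I) * (α k : ℂ)) = 1 := by
    have := Complex.exp_int_mul_two_pi_mul_I (-α k)
    rw [← this]; congr 1; push_cast; ring
  rw [this, mul_one]

lemma hasFDerivAt_negExp {n : ℕ} (α : Fin n → ℤ) (x : Fin n → ℝ) :
    ∃ L : (Fin n → ℝ) →L[ℝ] ℂ, HasFDerivAt (negExp α) L x ∧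
      ∀ k, L (Pi.single k 1) = -(2 * Real.pi * Complex.I) * α k * negExp α x := by
  have h1 : HasFDerivAt (fun x : Fin n → ℝ => -(2 * Real.pi * Complex.I) *
      ∑ k, (α k : ℂ) * (x k : ℂ)) (-(2 * Real.pi * Complex.I) •
        ∑ k, (α k : ℂ) • (Complex.ofRealCLM ∘L ContinuousLinearMap.proj (R := ℝ) (φ := fun _ : Fin n => ℝ) k)) x := by
    refine HasFDerivAt.const_mul (HasFDerivAt.fun_sum fun k _ => ?_) _
    refine HasFDerivAt.const_mul ?_ _
    exact (Complex.ofRealCLM ∘L ContinuousLinearMap.proj (R := ℝ) (φ := fun _ : Fin n => ℝ) k).hasFDerivAt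
  refine ⟨_, h1.cexp, fun k => ?_⟩
  have h2 : ∑ j, (α j : ℂ) * (((Pi.single k (1 : ℝ) : Fin n → ℝ) j : ℝ) : ℂ) = α k := by
    simp [Pi.single_apply, apply_ite (Complex.ofReal)]
  simp only [negExp, _root_.smul_apply, _root_.sum_apply,
    ContinuousLinearMap.comp_apply, ContinuousLinearMap.proj_apply, Complex.ofRealCLM_apply,
    smul_eq_mul, h2]
  ring

lemma SmoothPeriodic.fderiv {n : ℕ} {g : (Fin n → ℝ) → ℂ} (hg : SmoothPeriodic g) (k : Fin n) :
    SmoothPeriodic fun x => fderiv ℝ g x (Pi.single k 1) where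
  contDiff := (hg.contDiff.fderiv_right (m := ((⊤ : ℕ∞) : WithTop ℕ∞)) le_rfl).clm_apply
    contDiff_const
  periodic x j := by
    have : (fun y => g (y + Pi.single j 1)) = g := funext fun y => hg.periodic y j
    rw [← fderiv_comp_add_right, this]

/-- Integration by parts in direction `k`: the divergence theorem is applied to the field whose only
nonzero component, the `k`-th, is `negExp α * g`. By periodicity the fluxes through opposite faces
cancel. -/
lemma boxCoeff_fderiv {n : ℕ} {g : (Fin n → ℝ) → ℂ} (hg : SmoothPeriodic g) (k : Fin n)
    (α : Fin n → ℤ) :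
    boxCoeff (fun x => _root_.fderiv ℝ g x (Pi.single k 1)) α =
      (2 * Real.pi * Complex.I) * α k * boxCoeff g α := by
  obtain ⟨n, rfl⟩ : ∃ m, n = m + 1 := ⟨n - 1, by have := k.2; lia⟩
  choose L hL hLk using hasFDerivAt_negExp α
  have hgd : ∀ x, HasFDerivAt g (_root_.fderiv ℝ g x) x := fun x =>
    ((hg.contDiff.differentiable (by simp)) x).hasFDerivAt
  have hprod : ∀ x, HasFDerivAt (fun x => negExp α x * g x)
      (negExp α x • _root_.fderiv ℝ g x + g x • L x) x := fun x => (hL x).mul (hgd x)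
  have hcont : Continuous fun x => negExp α x * g x :=
    (continuous_negExp α).mul hg.contDiff.continuous
  have hcd : Continuous fun x => negExp α x * _root_.fderiv ℝ g x (Pi.single k 1) :=
    (continuous_negExp α).mul (hg.fderiv k).contDiff.continuous
  have hsum : ∀ x, ∑ i, (if i = k then (negExp α x • _root_.fderiv ℝ g x + g x • L x) else 0 :
      (Fin (n + 1) → ℝ) →L[ℝ] ℂ) (Pi.single i 1) =
        negExp α x * _root_.fderiv ℝ g x (Pi.single k 1) -
          (2 * Real.pi * Complex.I) * α k * (negExp α x * g x) := by
    intro x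
    rw [Finset.sum_eq_single k (fun i _ hi => by simp [hi]) (by simp)]
    simp [hLk]
    ring
  have key := integral_divergence_of_hasFDerivAt_off_countable' (0 : Fin (n + 1) → ℝ) 1
    zero_le_one (fun i x => if i = k then negExp α x * g x else 0)
    (fun i x => if i = k then (negExp α x • _root_.fderiv ℝ g x + g x • L x) else 0) ∅
    Set.countable_empty
    (fun i => by by_cases h : i = k <;> simp [h, hcont.continuousOn, continuousOn_const])
    (fun x _ i => by
      by_cases h : i = k
      · simpa [h] using hprod x
      · simp only [h, if_false]; exact hasFDerivAt_const _ _)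
    (by
      simp only [hsum]
      exact (hcd.sub (continuous_const.mul hcont)).continuousOn.integrableOn_Icc)
  simp only [hsum] at key
  have hi2 : IntegrableOn (fun x => (2 * Real.pi * Complex.I) * α k * (negExp α x * g x))
      (Set.Icc (0 : Fin (n + 1) → ℝ) 1) :=
    (continuous_const.mul hcont).continuousOn.integrableOn_Icc
  rw [integral_sub hcd.continuousOn.integrableOn_Icc hi2, integral_const_mul] at key
  rw [boxCoeff, boxCoeff, ← sub_eq_zero, key]
  refine Finset.sum_eq_zero fun i _ => ?_
  rw [sub_eq_zero]
  refine integral_congr_ae (Filter.Eventually.of_forall fun x => ?_)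
  by_cases h : i = k
  · subst h
    have hs : (i.insertNth ((1 : Fin (n + 1) → ℝ) i) x : Fin (n + 1) → ℝ) =
        (i.insertNth ((0 : Fin (n + 1) → ℝ) i) x : Fin (n + 1) → ℝ) + Pi.single i 1 := by
      ext j
      refine Fin.succAboveCases i ?_ (fun j => ?_) j
      · simp
      · simp
    simp only [if_true]
    rw [hs, negExp_add_single, hg.periodic]
  · simp [h]

lemma exists_bound_boxCoeff {n : ℕ} (g : (Fin n → ℝ) → ℂ) :
    ∃ D : ℝ, ∀ α, ‖boxCoeff g α‖ ≤ D := by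
  refine ⟨∫ x in Set.Icc (0 : Fin n → ℝ) 1, ‖g x‖, fun α => ?_⟩
  refine (norm_integral_le_integral_norm _).trans (le_of_eq ?_)
  simp [norm_negExp]

/-- Each entry `k` of the list costs one derivative in direction `k`. The list may repeat
directions, so listing every coordinate `M` times gives decay of any polynomial order. -/
lemma exists_bound_prod_mul_boxCoeff {n : ℕ} (l : List (Fin n)) :
    ∀ {g : (Fin n → ℝ) → ℂ}, SmoothPeriodic g → ∃ D : ℝ, ∀ α : Fin n → ℤ,
      (l.map fun k => 1 + |(α k : ℝ)|).prod * ‖boxCoeff g α‖ ≤ D := by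
  induction l with
  | nil => intro g _; simpa using exists_bound_boxCoeff g
  | cons k l ih =>
    intro g hg
    obtain ⟨D1, h1⟩ := ih hg
    obtain ⟨D2, h2⟩ := ih (hg.fderiv k)
    refine ⟨D1 + D2, fun α => ?_⟩
    have hP : 0 ≤ (l.map fun k => 1 + |(α k : ℝ)|).prod :=
      List.prod_nonneg (by simp; intros; positivity)
    have h3 : |(α k : ℝ)| * ‖boxCoeff g α‖ ≤
        ‖boxCoeff (fun x => fderiv ℝ g x (Pi.single k 1)) α‖ := by
      rw [boxCoeff_fderiv hg]
      simp only [norm_mul, Complex.norm_I, Complex.norm_real, Complex.norm_ofNat, mul_one,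
        Complex.norm_intCast, Real.norm_eq_abs, abs_of_pos Real.pi_pos]
      refine mul_le_mul_of_nonneg_right ?_ (norm_nonneg _)
      nlinarith [Real.pi_gt_three, abs_nonneg (α k : ℝ)]
    have h4 := mul_le_mul_of_nonneg_left h3 hP
    have := h1 α
    have := h2 α
    simp only [List.map_cons, List.prod_cons]
    nlinarith

lemma exists_bound_prod_pow_mul_boxCoeff {n : ℕ} (M : ℕ) {g : (Fin n → ℝ) → ℂ}
    (hg : SmoothPeriodic g) : ∃ D : ℝ, ∀ α : Fin n → ℤ,
      (∏ k, (1 + |(α k : ℝ)|) ^ M) * ‖boxCoeff g α‖ ≤ D := by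
  obtain ⟨D, hD⟩ := exists_bound_prod_mul_boxCoeff
    ((List.replicate M (List.finRange n)).flatten) hg
  refine ⟨D, fun α => ?_⟩
  convert hD α using 2
  rw [Finset.prod_pow, List.map_flatten, List.prod_flatten]
  simp [List.prod_ofFn, List.map_replicate, ← List.ofFn_eq_map]

lemma summable_prod_inv_sq (n : ℕ) :
    Summable fun α : Fin n → ℤ => ∏ k, ((1 + |(α k : ℝ)|) ^ 2)⁻¹ := by
  induction n with
  | zero => exact Summable.of_finite
  | succ n ih =>
    have h1 : Summable fun a : ℤ => ((1 + |(a : ℝ)|) ^ 2)⁻¹ := by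
      have := (Real.summable_one_div_int_pow (p := 2)).2 (by norm_num)
      refine Summable.of_norm_bounded_eventually this ?_
      refine (Set.finite_singleton (0 : ℤ)).subset fun a ha => ?_
      by_contra h0
      refine ha ?_
      have h0' : (0 : ℝ) < |(a : ℝ)| := by simpa using h0
      change ‖((1 + |(a : ℝ)|) ^ 2)⁻¹‖ ≤ 1 / (a : ℝ) ^ 2
      rw [Real.norm_of_nonneg (by positivity), one_div, ← sq_abs (a : ℝ)]
      gcongr
      linarith
    have h2 := h1.mul_of_nonneg ih (fun a => by positivity)
      (fun α => Finset.prod_nonneg fun k _ => by positivity)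
    rw [← (Fin.consEquiv fun _ : Fin (n + 1) => ℤ).summable_iff]
    refine h2.congr fun x => ?_
    simp [Fin.prod_univ_succ, Fin.consEquiv, mul_comm]

lemma summable_norm_boxCoeff {n : ℕ} (M : ℕ) {g : (Fin n → ℝ) → ℂ} (hg : SmoothPeriodic g) :
    Summable fun α : Fin n → ℤ => ‖boxCoeff g α‖ * ∏ k, (1 + |(α k : ℝ)|) ^ M := by
  -- The two extra powers in each variable pay for summability over `ℤ^n`.
  obtain ⟨D, hD⟩ := exists_bound_prod_pow_mul_boxCoeff (M + 2) hg
  refine Summable.of_nonneg_of_le (fun α => by positivity) (fun α => ?_)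
    ((summable_prod_inv_sq n).mul_left D)
  have h : ∏ k, (1 + |(α k : ℝ)|) ^ (M + 2) =
      (∏ k, (1 + |(α k : ℝ)|) ^ M) * ∏ k, (1 + |(α k : ℝ)|) ^ 2 := by
    rw [← Finset.prod_mul_distrib]; simp [pow_add]
  have hD' := hD α
  rw [Finset.prod_inv_distrib, ← div_eq_mul_inv, le_div_iff₀ (Finset.prod_pos fun k _ => by
    positivity)]
  rw [h] at hD'
  linarith

end Kissing

/-! ### Chebyshev series on the cube and asymptotics of cube integrals. -/

namespace Kissing

open Polynomial MeasureTheory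

lemma cube_eq_pi (n : ℕ) : cube n = Set.pi Set.univ fun _ => Set.Icc (-1 : ℝ) 1 := by
  ext x
  simp only [cube, Set.mem_pi, Set.mem_univ, true_implies, Set.mem_ofPred_eq]

lemma isCompact_cube (n : ℕ) : IsCompact (cube n) := by
  rw [cube_eq_pi]
  exact isCompact_univ_pi fun _ => isCompact_Icc

/-- The cosine maps all of `ℝ^n` into the cube, so smoothness within the closed cube becomes global
smoothness, with no boundary left. -/
lemma smoothPeriodic_comp_cos {n : ℕ} {f : (Fin n → ℝ) → ℂ}
    (hf : ContDiffOn ℝ ((⊤ : ℕ∞) : WithTop ℕ∞) f (cube n)) :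
    SmoothPeriodic fun x => f fun k => Real.cos (2 * Real.pi * x k) where
  contDiff := by
    rw [← contDiffOn_univ]
    refine hf.comp (t := cube n) (ContDiff.contDiffOn ?_) fun x _ k => Real.cos_mem_Icc _
    exact contDiff_pi.2 fun k => Real.contDiff_cos.comp (contDiff_const.mul (contDiff_apply ℝ ℝ k))
  periodic x j := by
    congr 1
    ext k
    by_cases h : k = j
    · subst h
      simp [mul_add]
    · simp [h]

/-- The function `t ↦ f(cos 2πt)` on the torus. -/
noncomputable def torusFun {n : ℕ} (f : (Fin n → ℝ) → ℂ) (hf : ContinuousOn f (cube n)) :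
    C(UnitAddTorus (Fin n), ℂ) where
  toFun t := f fun k => (fourier 1 (t k) : ℂ).re
  continuous_toFun := by
    refine hf.comp_continuous (by fun_prop) fun t k => ?_
    rw [Set.mem_Icc, ← abs_le]
    refine (Complex.abs_re_le_norm _).trans ?_
    rw [fourier_apply]
    exact (Circle.norm_coe _).le

lemma torusFun_coe {n : ℕ} {f : (Fin n → ℝ) → ℂ} (hf : ContinuousOn f (cube n)) (x : Fin n → ℝ) :
    torusFun f hf (fun k => (x k : UnitAddCircle)) =
      f fun k => Real.cos (2 * Real.pi * x k) := by
  change f _ = f _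
  congr 1
  ext k
  rw [fourier_coe_apply, show 2 * (Real.pi : ℂ) * Complex.I * ((1 : ℤ) : ℂ) * (x k : ℂ) /
    ((1 : ℝ) : ℂ) = ((2 * Real.pi * x k : ℝ) : ℂ) * Complex.I by push_cast; ring]
  exact Complex.exp_ofReal_mul_I_re _

lemma mFourier_coe {n : ℕ} (α : Fin n → ℤ) (x : Fin n → ℝ) :
    UnitAddTorus.mFourier α (fun k => (x k : UnitAddCircle)) =
      ∏ k, Complex.exp (2 * Real.pi * Complex.I * α k * x k) := by
  change ∏ k, fourier (α k) (x k : UnitAddCircle) = _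
  refine Finset.prod_congr rfl fun k _ => ?_
  rw [fourier_coe_apply]
  simp

lemma mFourierCoeff_torusFun {n : ℕ} {f : (Fin n → ℝ) → ℂ} (hf : ContinuousOn f (cube n))
    (α : Fin n → ℤ) : UnitAddTorus.mFourierCoeff (torusFun f hf) α =
      boxCoeff (fun x => f fun k => Real.cos (2 * Real.pi * x k)) α := by
  rw [UnitAddTorus.mFourierCoeff_eq_integral _ _ 0, boxCoeff]
  have hs : {x : Fin n → ℝ | ∀ i, x i ∈ Set.Ioc ((0 : Fin n → ℝ) i) ((0 : Fin n → ℝ) i + 1)} =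
      Set.pi Set.univ fun i => Set.Ioc ((0 : Fin n → ℝ) i) ((1 : Fin n → ℝ) i) := by
    ext; simp
  rw [hs, volume_pi, setIntegral_congr_set (Measure.univ_pi_Ioc_ae_eq_Icc (f := (0 : Fin n → ℝ)) (g := 1))]
  refine integral_congr_ae (Filter.Eventually.of_forall fun x => ?_)
  simp only [mFourier_coe, torusFun_coe, smul_eq_mul]
  congr 1
  rw [negExp, ← Complex.exp_sum, Finset.mul_sum]
  congr 1
  refine Finset.sum_congr rfl fun k _ => ?_
  simp
  ring

lemma sum_sgn_exp (a : ℤ) (φ : ℝ) :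
    ∑ s : Bool, Complex.exp (Complex.I * a * (sgn s * φ)) =
      2 * (((Chebyshev.T ℝ a).eval (Real.cos φ) : ℝ) : ℂ) := by
  rw [Chebyshev.T_real_cos, Complex.ofReal_cos, Complex.two_cos]
  simp only [Fintype.sum_bool, sgn_true, sgn_false]
  push_cast
  congr 2 <;> ring

/-- A smooth function on the cube has an absolutely convergent Chebyshev series with rapidly
decaying coefficients. -/
theorem exists_chebyshev_series {n : ℕ} {f : (Fin n → ℝ) → ℂ}
    (hf : ContDiffOn ℝ ((⊤ : ℕ∞) : WithTop ℕ∞) f (cube n)) :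
    ∃ c : (Fin n → ℤ) → ℂ,
      (∀ M : ℕ, Summable fun α : Fin n → ℤ => ‖c α‖ * ∏ k, (1 + |(α k : ℝ)|) ^ M) ∧
      ∀ x ∈ cube n, HasSum
        (fun α : Fin n → ℤ => c α * ∏ k, (((Chebyshev.T ℝ (α k)).eval (x k) : ℝ) : ℂ)) (f x) := by
  have hg := smoothPeriodic_comp_cos hf
  set g : (Fin n → ℝ) → ℂ := fun x => f fun k => Real.cos (2 * Real.pi * x k) with hgdef
  refine ⟨boxCoeff g, fun M => summable_norm_boxCoeff M hg, fun x hx => ?_⟩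
  have hco : UnitAddTorus.mFourierCoeff (torusFun f hf.continuousOn) = boxCoeff g :=
    funext fun α => mFourierCoeff_torusFun _ α
  have hsum : Summable (UnitAddTorus.mFourierCoeff (torusFun f hf.continuousOn)) := by
    rw [hco]
    refine Summable.of_norm ?_
    simpa using summable_norm_boxCoeff 0 hg
  -- All sign choices `±arccos (x k)` represent the same point `x`. Averaging the Fourier series
  -- over them turns exponentials into cosines, that is, into `T_{α k}(x k)` with integer index.
  have hser : ∀ ε : Fin n → Bool, HasSum (fun α : Fin n → ℤ => boxCoeff g α *
      ∏ k, Complex.exp (Complex.I * α k * (sgn (ε k) * Real.arccos (x k)))) (f x) := by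
    intro ε
    have h := UnitAddTorus.hasSum_mFourier_series_apply_of_summable hsum
      (fun k => ((sgn (ε k) * Real.arccos (x k) / (2 * Real.pi) : ℝ) : UnitAddCircle))
    have hval : (fun k => Real.cos (2 * Real.pi * (sgn (ε k) * Real.arccos (x k) / (2 * Real.pi))))
        = x := by
      ext k
      rw [mul_div_cancel₀ _ (by positivity)]
      have := Real.cos_arccos (hx k).1 (hx k).2
      cases ε k <;> simp [this]
    rw [torusFun_coe, hval, hco] at h
    refine h.congr_fun fun α => ?_
    rw [mFourier_coe, smul_eq_mul]
    congr 1
    refine Finset.prod_congr rfl fun k _ => ?_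
    congr 1
    have hpi : (Real.pi : ℂ) ≠ 0 := by exact_mod_cast Real.pi_ne_zero
    push_cast
    field_simp
  have hall := hasSum_sum (s := Finset.univ) fun ε _ => hser ε
  have h2 : (2 : ℂ) ^ n ≠ 0 := by simp
  have := hall.mul_left ((2 : ℂ) ^ n)⁻¹
  simp only [Finset.sum_const, Finset.card_univ, Fintype.card_pi, Fintype.card_bool,
    Finset.prod_const, Fintype.card_fin, nsmul_eq_mul, Nat.cast_pow, Nat.cast_ofNat,
    inv_mul_cancel_left₀ h2] at this
  refine this.congr_fun fun α => ?_
  rw [← Finset.mul_sum, mul_left_comm]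
  congr 1
  have hp := Finset.prod_univ_sum (fun _ : Fin n => (Finset.univ : Finset Bool))
    fun k s => Complex.exp (Complex.I * α k * (sgn s * Real.arccos (x k)))
  rw [Fintype.piFinset_univ] at hp
  rw [← hp, Finset.prod_congr rfl fun k _ => sum_sgn_exp (α k) (Real.arccos (x k)),
    Finset.prod_mul_distrib]
  simp only [Finset.prod_const, Finset.card_univ, Fintype.card_fin, inv_mul_cancel_left₀ h2]
  exact Finset.prod_congr rfl fun k _ => by rw [Real.cos_arccos (hx k).1 (hx k).2]

/-- Replace one factor at a time. Since `δ ≤ 1`, each `A i` has norm at most `2 * q i`; the `3` is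
this `2` plus the `1` from the replaced factor. -/
lemma norm_prod_sub_prod_le {ι : Type*} (s : Finset ι) {A L : ι → ℂ} {q : ι → ℝ} {δ : ℝ}
    (h0 : 0 ≤ δ) (h1 : δ ≤ 1) (hq : ∀ i, 0 ≤ q i) (hL : ∀ i, ‖L i‖ ≤ q i)
    (hA : ∀ i, ‖A i - L i‖ ≤ q i * δ) :
    ‖∏ i ∈ s, A i - ∏ i ∈ s, L i‖ ≤ δ * ∏ i ∈ s, (3 * q i) := by
  classical
  induction s using Finset.induction_on with
  | empty => simpa using h0
  | insert i s hi ih =>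
    rw [Finset.prod_insert hi, Finset.prod_insert hi, Finset.prod_insert hi]
    have hP : 0 ≤ ∏ j ∈ s, (3 * q j) := Finset.prod_nonneg fun j _ => by linarith [hq j]
    have hLs : ‖∏ j ∈ s, L j‖ ≤ ∏ j ∈ s, (3 * q j) := by
      rw [norm_prod]
      exact Finset.prod_le_prod (fun _ _ => norm_nonneg _) fun j _ =>
        (hL j).trans (by linarith [hq j])
    have hAi : ‖A i‖ ≤ 2 * q i := by
      have := norm_add_le (A i - L i) (L i)
      rw [sub_add_cancel] at this
      nlinarith [hA i, hL i, hq i]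
    calc ‖A i * ∏ j ∈ s, A j - L i * ∏ j ∈ s, L j‖
        = ‖A i * (∏ j ∈ s, A j - ∏ j ∈ s, L j) + (A i - L i) * ∏ j ∈ s, L j‖ := by ring_nf
      _ ≤ 2 * q i * (δ * ∏ j ∈ s, (3 * q j)) + q i * δ * ∏ j ∈ s, (3 * q j) := by
          refine (norm_add_le _ _).trans (add_le_add ?_ ?_) <;> rw [norm_mul]
          · exact mul_le_mul hAi ih (norm_nonneg _) (by linarith [hq i])
          · exact mul_le_mul (hA i) hLs (norm_nonneg _) (mul_nonneg (hq i) h0)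
      _ = _ := by ring

lemma integral_cube_prod {n : ℕ} (h : Fin n → ℝ → ℂ) :
    ∫ x in cube n, ∏ k, h k (x k) = ∏ k, ∫ x in (-1 : ℝ)..1, h k x := by
  rw [cube_eq_pi, volume_pi, Measure.restrict_pi_pi, integral_fintype_prod_eq_prod]
  refine Finset.prod_congr rfl fun k _ => ?_
  rw [intervalIntegral.integral_of_le (by norm_num), integral_Icc_eq_integral_Ioc]

/-- Dominated convergence, with `|T_a| ≤ 1` on `[-1,1]`. Each term of the series is a product of
one-variable functions, so its integral factorises. -/
lemma hasSum_integral_cube {n : ℕ} {f : (Fin n → ℝ) → ℂ} {c : (Fin n → ℤ) → ℂ}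
    (hc : Summable fun α => ‖c α‖)
    (hf : ∀ x ∈ cube n, HasSum
        (fun α : Fin n → ℤ => c α * ∏ k, (((Chebyshev.T ℝ (α k)).eval (x k) : ℝ) : ℂ)) (f x))
    (w : Fin n → ℝ[X]) (ω : ℝ) :
    HasSum (fun α : Fin n → ℤ => c α * ∏ k, osc (w k * Chebyshev.T ℝ (α k)) ω)
      (∫ x in cube n, f x * ∏ k, (((w k).eval (x k) : ℝ) : ℂ) *
        Complex.exp (Complex.I * ω * x k)) := by
  choose B hB0 hB using fun k => exists_bound_eval_of_abs_le_one (w k)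
  have hexp : ∀ y : ℝ, ‖Complex.exp (Complex.I * ω * y)‖ = 1 := fun y => by
    rw [show Complex.I * (ω : ℂ) * (y : ℂ) = ((ω * y : ℝ) : ℂ) * Complex.I by push_cast; ring]
    exact Complex.norm_exp_ofReal_mul_I _
  have hms : MeasurableSet (cube n) := (isCompact_cube n).isClosed.measurableSet
  have hfin : IsFiniteMeasure (volume.restrict (cube n)) :=
    ⟨by simpa using (isCompact_cube n).measure_lt_top⟩
  have key := hasSum_integral_of_dominated_convergence (μ := volume.restrict (cube n))
    (F := fun (α : Fin n → ℤ) x => c α * ∏ k, ((((w k * Chebyshev.T ℝ (α k)).eval (x k) : ℝ) : ℂ) *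
        Complex.exp (Complex.I * ω * x k)))
    (f := fun x => f x * ∏ k, (((w k).eval (x k) : ℝ) : ℂ) *
        Complex.exp (Complex.I * ω * x k))
    (fun α _ => ‖c α‖ * ∏ k, B k) (fun α => ?_) (fun α => ?_) ?_ ?_ ?_
  · refine key.congr_fun fun α => ?_
    rw [integral_const_mul, integral_cube_prod (fun k y =>
      (((w k * Chebyshev.T ℝ (α k)).eval y : ℝ) : ℂ) * Complex.exp (Complex.I * ω * y))]
    rfl
  · refine Continuous.aestronglyMeasurable ?_
    have : ∀ p : ℝ[X], Continuous fun y => p.eval y := fun p => p.continuous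
    fun_prop
  · refine (ae_restrict_iff' hms).2 (Filter.Eventually.of_forall fun x hx => ?_)
    rw [norm_mul, norm_prod]
    refine mul_le_mul_of_nonneg_left (Finset.prod_le_prod (fun _ _ => norm_nonneg _)
      fun k _ => ?_) (norm_nonneg _)
    have hxk : |x k| ≤ 1 := abs_le.2 (hx k)
    rw [norm_mul, hexp, mul_one, Complex.norm_real, eval_mul, norm_mul]
    have h1 := Chebyshev.abs_eval_T_real_le_one (α k) hxk
    have h2 := hB k (x k) hxk
    exact (mul_le_of_le_one_right (norm_nonneg _) h1).trans h2
  · exact Filter.Eventually.of_forall fun x => hc.mul_right _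
  · exact integrable_const _
  · refine (ae_restrict_iff' hms).2 (Filter.Eventually.of_forall fun x hx => ?_)
    refine ((hf x hx).mul_right (∏ k, (((w k).eval (x k) : ℝ) : ℂ) *
        Complex.exp (Complex.I * ω * x k))).congr_fun fun α => ?_
    rw [mul_assoc, ← Finset.prod_mul_distrib]
    congr 1
    refine Finset.prod_congr rfl fun k _ => ?_
    rw [eval_mul]
    push_cast
    ring

/-- The vertex of the cube with signs `ε`. -/
def vertex {n : ℕ} (ε : Fin n → Bool) : Fin n → ℝ := fun k => sgn (ε k)

lemma vertex_mem_cube {n : ℕ} (ε : Fin n → Bool) : vertex ε ∈ cube n := by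
  intro k
  unfold vertex
  cases ε k <;> simp

/-- Leading asymptotics of `∫ f(x) ∏ (x_k-1)^{p_k} (x_k+1)^{q_k} e^{iωx_k} dx` over the cube. -/
theorem isBigO_integral_cube {n : ℕ} {f : (Fin n → ℝ) → ℂ}
    (hf : ContDiffOn ℝ ((⊤ : ℕ∞) : WithTop ℕ∞) f (cube n)) {p q m : Fin n → ℕ}
    (hp : ∀ k, m k ≤ p k) (hq : ∀ k, m k ≤ q k) :
    (fun ω : ℝ => (∫ x in cube n, f x * ∏ k, (((endWeight (p k) (q k)).eval (x k) : ℝ) : ℂ) *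
        Complex.exp (Complex.I * ω * x k)) -
      ((ω : ℂ) ^ ∑ k, (m k + 1))⁻¹ * ∑ ε : Fin n → Bool,
        (∏ k, endCoef (p k) (q k) (m k) (ε k) * Complex.exp (Complex.I * ω * sgn (ε k))) *
          f (vertex ε))
      =O[Filter.atTop] fun ω : ℝ => (ω ^ (∑ k, (m k + 1) + 1))⁻¹ := by
  obtain ⟨c, hc, hser⟩ := exists_chebyshev_series hf
  choose D hD0 hD using fun k => exists_bound_osc_endWeight_mul_T (hp k) (hq k)
  -- One exponent that dominates every `2 * (m k + 2)`. Below, `K k` bounds both the leading term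
  -- and the error in the `k`-th variable.
  set M : ℕ := 2 * (∑ k, m k + 2) with hM
  set K : Fin n → ℝ := fun k => D k + ∑ s : Bool, ‖endCoef (p k) (q k) (m k) s‖ with hK
  have hK0 : ∀ k, 0 ≤ K k := fun k => add_nonneg (hD0 k) (Finset.sum_nonneg fun _ _ => norm_nonneg _)
  have hc0 : Summable fun α => ‖c α‖ := by simpa using hc 0
  set S : ℝ := ∑' α : Fin n → ℤ, ‖c α‖ * ∏ k, (1 + |(α k : ℝ)|) ^ M with hS
  refine IsBigO.of_bound ((∏ k, (3 * K k)) * S) ?_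
  filter_upwards [Filter.eventually_ge_atTop (1 : ℝ)] with ω hω
  have hω0 : 0 < ω := by linarith
  have hexp : ∀ y : ℝ, ‖Complex.exp (Complex.I * ω * y)‖ = 1 := fun y => by
    rw [show Complex.I * (ω : ℂ) * (y : ℂ) = ((ω * y : ℝ) : ℂ) * Complex.I by push_cast; ring]
    exact Complex.norm_exp_ofReal_mul_I _
  set L : Fin n → ℤ → ℂ := fun k a => ((ω : ℂ) ^ (m k + 1))⁻¹ * ∑ s : Bool,
          endCoef (p k) (q k) (m k) s * Complex.exp (Complex.I * ω * sgn s) *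
            (((Chebyshev.T ℝ a).eval (sgn s) : ℝ) : ℂ) with hL
  -- Multiplying out the two-endpoint sums produces one term per vertex, and there the Chebyshev
  -- series sums back to `f`.
  have hmain : HasSum (fun α : Fin n → ℤ => c α * ∏ k, L k (α k))
      (((ω : ℂ) ^ ∑ k, (m k + 1))⁻¹ * ∑ ε : Fin n → Bool,
        (∏ k, endCoef (p k) (q k) (m k) (ε k) * Complex.exp (Complex.I * ω * sgn (ε k))) *
          f (vertex ε)) := by
    have h := (hasSum_sum (s := Finset.univ) fun (ε : Fin n → Bool) _ =>
      (hser _ (vertex_mem_cube ε)).mul_left (∏ k, endCoef (p k) (q k) (m k) (ε k) *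
        Complex.exp (Complex.I * ω * sgn (ε k)))).mul_left ((ω : ℂ) ^ ∑ k, (m k + 1))⁻¹
    refine h.congr_fun fun α => ?_
    have hpr := Finset.prod_univ_sum (fun _ : Fin n => (Finset.univ : Finset Bool))
      fun k s => endCoef (p k) (q k) (m k) s * Complex.exp (Complex.I * ω * sgn s) *
            (((Chebyshev.T ℝ (α k)).eval (sgn s) : ℝ) : ℂ)
    rw [Fintype.piFinset_univ] at hpr
    simp only [hL]
    rw [Finset.prod_mul_distrib, hpr, Finset.prod_inv_distrib, Finset.prod_pow_eq_pow_sum,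
      mul_left_comm, Finset.mul_sum]
    congr 1
    refine Finset.sum_congr rfl fun ε _ => ?_
    rw [Finset.prod_mul_distrib, mul_left_comm]
    rfl
  have hdiff := (hasSum_integral_cube hc0 hser (fun k => endWeight (p k) (q k)) ω).sub hmain
  have hbound : ∀ α : Fin n → ℤ, ‖c α * ∏ k, osc (endWeight (p k) (q k) * Chebyshev.T ℝ (α k)) ω -
      c α * ∏ k, L k (α k)‖ ≤ ((∏ k, (3 * K k)) * (ω ^ (∑ k, (m k + 1) + 1))⁻¹) *
        (‖c α‖ * ∏ k, (1 + |(α k : ℝ)|) ^ M) := by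
    intro α
    have hA : ∀ k, (1 : ℝ) ≤ 1 + |(α k : ℝ)| := fun k => by linarith [abs_nonneg (α k : ℝ)]
    have hMk : ∀ k, (1 + |(α k : ℝ)|) ^ (2 * (m k + 2)) ≤ (1 + |(α k : ℝ)|) ^ M := fun k =>
      pow_le_pow_right₀ (hA k) (by
        have := Finset.single_le_sum (f := m) (fun i _ => Nat.zero_le _) (Finset.mem_univ k)
        lia)
    have := norm_prod_sub_prod_le Finset.univ
      (A := fun k => osc (endWeight (p k) (q k) * Chebyshev.T ℝ (α k)) ω)
      (L := fun k => L k (α k))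
      (q := fun k => K k * (1 + |(α k : ℝ)|) ^ M * (ω ^ (m k + 1))⁻¹) (δ := ω⁻¹)
      (by positivity) (inv_le_one_of_one_le₀ hω)
      (fun k => mul_nonneg (mul_nonneg (hK0 k) (by positivity)) (by positivity))
      (fun k => ?_) (fun k => ?_)
    · rw [← mul_sub, norm_mul]
      refine (mul_le_mul_of_nonneg_left this (norm_nonneg _)).trans (le_of_eq ?_)
      simp only [Finset.prod_mul_distrib, Finset.prod_inv_distrib, Finset.prod_pow_eq_pow_sum]
      rw [pow_succ ω, mul_inv]
      ring
    · simp only [hL]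
      rw [norm_mul, norm_inv, norm_pow, Complex.norm_real, Real.norm_of_nonneg hω0.le, mul_comm]
      refine mul_le_mul_of_nonneg_right ?_ (by positivity)
      refine (norm_sum_le _ _).trans ?_
      have h1 : ∑ s : Bool, ‖endCoef (p k) (q k) (m k) s * Complex.exp (Complex.I * ω * sgn s) *
            (((Chebyshev.T ℝ (α k)).eval (sgn s) : ℝ) : ℂ)‖ ≤ K k := by
        refine le_trans (Finset.sum_le_sum fun s _ => ?_) (le_add_of_nonneg_left (hD0 k))
        rw [norm_mul, norm_mul, hexp, mul_one, Complex.norm_real]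
        refine mul_le_of_le_one_right (norm_nonneg _) (Chebyshev.abs_eval_T_real_le_one _ ?_)
        cases s <;> simp
      exact h1.trans (le_mul_of_one_le_right (hK0 k) (one_le_pow₀ (hA k)))
    · refine (hD k (α k) ω hω).trans ?_
      rw [show (ω ^ (m k + 2))⁻¹ = (ω ^ (m k + 1))⁻¹ * ω⁻¹ by rw [← mul_inv, ← pow_succ],
        ← mul_assoc]
      refine mul_le_mul_of_nonneg_right (mul_le_mul_of_nonneg_right ?_ (by positivity))
        (by positivity)
      refine mul_le_mul ?_ (hMk k) (by positivity) (hK0 k)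
      exact le_add_of_nonneg_right (Finset.sum_nonneg fun _ _ => norm_nonneg _)
  have hfinal := hdiff.norm_le_of_bounded ((hc M).hasSum.mul_left _) hbound
  rw [Real.norm_of_nonneg (by positivity)]
  refine hfinal.trans (le_of_eq ?_)
  ring

end Kissing

/-! ### Symmetrisation and reduction to determinants at the vertices. -/

namespace Kissing

open Polynomial MeasureTheory

lemma comp_perm_mem_cube {n : ℕ} (σ : Equiv.Perm (Fin n)) {x : Fin n → ℝ} :
    (fun i => x (σ i)) ∈ cube n ↔ x ∈ cube n :=
  ⟨fun h i => by simpa using h (σ.symm i), fun h i => h (σ i)⟩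

lemma integral_cube_comp_perm {n : ℕ} (σ : Equiv.Perm (Fin n)) (G : (Fin n → ℝ) → ℂ) :
    ∫ x in cube n, G (fun i => x (σ i)) = ∫ x in cube n, G x := by
  have hmp := volume_measurePreserving_piCongrLeft (fun _ : Fin n => ℝ) σ.symm
  have hval : ∀ x : Fin n → ℝ, MeasurableEquiv.piCongrLeft (fun _ : Fin n => ℝ) σ.symm x =
      fun i => x (σ i) := by
    intro x
    ext i
    have := MeasurableEquiv.piCongrLeft_apply_apply σ.symm (β := fun _ => ℝ) x (σ i)
    simpa using this
  have := hmp.setIntegral_preimage_emb (MeasurableEquiv.measurableEmbedding _) G (cube n)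
  have hpre : (MeasurableEquiv.piCongrLeft (fun _ : Fin n => ℝ) σ.symm) ⁻¹' cube n = cube n := by
    ext x
    rw [Set.mem_preimage, hval, comp_perm_mem_cube]
  rw [hpre] at this
  rw [← this]
  simp only [hval]

section Symmetrize

variable {n : ℕ} (φ : Fin n → ℝ[X])

lemma vandermondeProd_eq_sum (hdeg : ∀ i, (φ i).natDegree = i) (hmon : ∀ i, (φ i).Monic)
    (x : Fin n → ℝ) : vandermondeProd x =
      ∑ σ : Equiv.Perm (Fin n), (σ.sign : ℝ) * ∏ k, (φ (σ k)).eval (x k) := by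
  rw [vandermondeProd, ← Matrix.det_vandermonde,
    Matrix.det_eval_matrixOfPolynomials_eq_det_vandermonde x φ hdeg hmon, ← Matrix.det_transpose,
    Matrix.det_apply']
  simp

lemma vandermondeProd_comp_perm (x : Fin n → ℝ) (σ : Equiv.Perm (Fin n)) :
    vandermondeProd (fun i => x (σ i)) = (σ.sign : ℝ) * vandermondeProd x := by
  rw [vandermondeProd, ← Matrix.det_vandermonde, vandermondeProd, ← Matrix.det_vandermonde,
    ← Matrix.det_permute]
  rfl

lemma continuous_vandermondeProd : Continuous fun x : Fin n → ℝ => vandermondeProd x := by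
  unfold vandermondeProd
  fun_prop

lemma exp_sum_eq_prod (ω : ℝ) (x : Fin n → ℝ) :
    Complex.exp (Complex.I * (ω : ℂ) * ((∑ j, x j : ℝ) : ℂ)) =
      ∏ k, Complex.exp (Complex.I * ω * x k) := by
  rw [← Complex.exp_sum, ← Finset.mul_sum]
  push_cast
  rfl

/-- For symmetric `f`, one Vandermonde factor can be replaced by the diagonal product of a monic
polynomial basis, at the cost of the factor `n!`. -/
theorem symmIntegral_eq_sum {f : (Fin n → ℝ) → ℂ} (hf : ContinuousOn f (cube n))
    (hsym : IsSymmetricFun f) (hdeg : ∀ i, (φ i).natDegree = i) (hmon : ∀ i, (φ i).Monic) (ω : ℝ) :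
    symmIntegral n f ω = ∑ τ : Equiv.Perm (Fin n), (τ.sign : ℂ) *
      ∫ x in cube n, f x * ∏ k, (((φ k * φ (τ k)).eval (x k) : ℝ) : ℂ) *
        Complex.exp (Complex.I * ω * x k) := by
  have hev : ∀ p : ℝ[X], Continuous fun y => p.eval y := fun p => p.continuous
  have hV := continuous_vandermondeProd (n := n)
  have hms : MeasurableSet (cube n) := (isCompact_cube n).isClosed.measurableSet
  have hint : ∀ g : (Fin n → ℝ) → ℂ, Continuous g →
      IntegrableOn (fun x => f x * g x) (cube n) := fun g hg =>
    (hf.mul hg.continuousOn).integrableOn_compact (isCompact_cube n)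
  set G : (Fin n → ℝ) → ℂ := fun x => f x * ((vandermondeProd x : ℝ) : ℂ) *
    (∏ k, (((φ k).eval (x k) : ℝ) : ℂ)) * ∏ k, Complex.exp (Complex.I * ω * x k) with hG
  have h1 : symmIntegral n f ω = ∫ x in cube n, G x := by
    have hfac : (n.factorial : ℂ) ≠ 0 := by exact_mod_cast n.factorial_ne_zero
    rw [symmIntegral, one_div, inv_mul_eq_iff_eq_mul₀ hfac]
    -- The sign from expanding one Vandermonde factor is absorbed by permuting the arguments of the
    -- other. The integrand is thus a sum of `n!` permuted copies of `G`, all with the same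
    -- integral.
    have hpt : ∀ x ∈ cube n, f x * ((vandermondeProd x : ℝ) : ℂ) ^ 2 *
        Complex.exp (Complex.I * (ω : ℂ) * ((∑ j, x j : ℝ) : ℂ)) =
          ∑ σ : Equiv.Perm (Fin n), G fun i => x (σ i) := by
      intro x hx
      simp only [hG, hsym _ x hx, vandermondeProd_comp_perm, exp_sum_eq_prod]
      rw [sq]
      nth_rewrite 2 [vandermondeProd_eq_sum φ hdeg hmon]
      rw [← Equiv.sum_comp (Equiv.inv (Equiv.Perm (Fin n)))]
      push_cast
      rw [Finset.mul_sum, Finset.mul_sum, Finset.sum_mul]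
      refine Finset.sum_congr rfl fun σ _ => ?_
      rw [Equiv.prod_comp σ fun k => Complex.exp (Complex.I * ω * x k),
        ← Equiv.prod_comp σ
          fun k => (((φ ((Equiv.inv (Equiv.Perm (Fin n))) σ k)).eval (x k) : ℝ) : ℂ)]
      simp only [Equiv.inv_apply, Equiv.Perm.inv_def, Equiv.Perm.sign_symm,
        Equiv.symm_apply_apply]
      ring
    rw [setIntegral_congr_fun hms hpt, integral_finsetSum]
    · simp only [integral_cube_comp_perm, Finset.sum_const, Finset.card_univ, Fintype.card_perm,
        Fintype.card_fin, nsmul_eq_mul]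
    · intro σ _
      have hx : ∀ x ∈ cube n, f x * (((vandermondeProd fun i => x (σ i) : ℝ) : ℂ) *
          (∏ k, (((φ k).eval (x (σ k)) : ℝ) : ℂ)) * ∏ k, Complex.exp (Complex.I * ω * x (σ k))) =
          G fun i => x (σ i) := by
        intro x hx
        simp only [hG, hsym _ x hx]
        ring
      refine (integrableOn_congr_fun hx hms).1 (hint _ ?_)
      have : Continuous fun x : Fin n → ℝ => vandermondeProd fun i => x (σ i) :=
        hV.comp (by fun_prop)
      fun_prop
  rw [h1]
  have hpt : ∀ x, G x = ∑ τ : Equiv.Perm (Fin n), (τ.sign : ℂ) * (f x *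
      ∏ k, (((φ k * φ (τ k)).eval (x k) : ℝ) : ℂ) * Complex.exp (Complex.I * ω * x k)) := by
    intro x
    simp only [hG]
    rw [vandermondeProd_eq_sum φ hdeg hmon]
    push_cast
    rw [Finset.mul_sum, Finset.sum_mul, Finset.sum_mul]
    refine Finset.sum_congr rfl fun τ _ => ?_
    simp only [eval_mul, Complex.ofReal_mul, Finset.prod_mul_distrib]
    ring
  simp only [hpt]
  rw [integral_finsetSum]
  · simp only [integral_const_mul]
  · intro τ _
    refine Integrable.const_mul (hint _ ?_) _
    fun_prop

end Symmetrize

/-- Order of vanishing at `1` of the `k`-th basis polynomial. -/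
def ordOne (k : ℕ) : ℕ := (k + 1) / 2

/-- Order of vanishing at `-1` of the `k`-th basis polynomial. -/
def ordNegOne (k : ℕ) : ℕ := k / 2

lemma endWeight_mul (p q p' q' : ℕ) :
    endWeight p q * endWeight p' q' = endWeight (p + p') (q + q') := by
  simp only [endWeight, pow_add]; ring

lemma monic_endWeight (p q : ℕ) : (endWeight p q).Monic :=
  ((monic_X_sub_C _).pow _).mul ((monic_X_sub_C _).pow _)

lemma natDegree_endWeight (p q : ℕ) : (endWeight p q).natDegree = p + q := by
  rw [endWeight, ((monic_X_sub_C _).pow _).natDegree_mul ((monic_X_sub_C _).pow _),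
    (monic_X_sub_C _).natDegree_pow, (monic_X_sub_C _).natDegree_pow, natDegree_X_sub_C,
    natDegree_X_sub_C, mul_one, mul_one]

/-- The matrix of leading coefficients at the vertex with signs `ε`. -/
noncomputable def coefMatrix {n : ℕ} (ε : Fin n → Bool) : Matrix (Fin n) (Fin n) ℂ :=
  Matrix.of fun k l => endCoef (ordOne k + ordOne l) (ordNegOne k + ordNegOne l)
    (ordNegOne k + ordNegOne l) (ε k)

/-- The exponent of `ω⁻¹` in the leading term of `I_n[f]`. -/
def leadExp (n : ℕ) : ℕ := ∑ k : Fin n, (2 * ordNegOne k + 1)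

/-- Leading asymptotics of `I_n[f]` for symmetric smooth `f`, as a sum over the vertices. -/
theorem isBigO_symmIntegral {n : ℕ} {f : (Fin n → ℝ) → ℂ}
    (hf : ContDiffOn ℝ ((⊤ : ℕ∞) : WithTop ℕ∞) f (cube n)) (hsym : IsSymmetricFun f) :
    (fun ω : ℝ => symmIntegral n f ω - ((ω : ℂ) ^ leadExp n)⁻¹ * ∑ ε : Fin n → Bool,
        (coefMatrix ε).det * Complex.exp (Complex.I * ω * ((∑ k, vertex ε k : ℝ) : ℂ)) *
          f (vertex ε))
      =O[Filter.atTop] fun ω : ℝ => (ω ^ (leadExp n + 1))⁻¹ := by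
  set φ : Fin n → ℝ[X] := fun k => endWeight (ordOne k) (ordNegOne k) with hφ
  have hdeg : ∀ i, (φ i).natDegree = i := fun i => by
    rw [hφ, natDegree_endWeight, ordOne, ordNegOne]; lia
  -- Reindexing by `τ` shows that all permutations contribute at the same power of `ω`; this is what
  -- assembles the coefficients into a determinant.
  have hE : ∀ τ : Equiv.Perm (Fin n), ∑ k : Fin n, (ordNegOne k + ordNegOne (τ k) + 1) =
      leadExp n := by
    intro τ
    rw [leadExp, Finset.sum_add_distrib, Finset.sum_add_distrib, Finset.sum_add_distrib,
      Equiv.sum_comp τ fun k : Fin n => ordNegOne k]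
    simp only [two_mul, Finset.sum_add_distrib]
  have h := fun τ : Equiv.Perm (Fin n) =>
    (isBigO_integral_cube hf (p := fun k => ordOne k + ordOne (τ k))
      (q := fun k => ordNegOne k + ordNegOne (τ k)) (m := fun k => ordNegOne k + ordNegOne (τ k))
      -- The order at `-1` never exceeds the order at `1`, so it serves as `m`.
      (fun k => by simp only [ordOne, ordNegOne]; lia) (fun k => le_rfl)).const_mul_left
        ((τ.sign : ℤ) : ℂ)
  simp only [hE] at h
  have hs := IsBigO.sum (s := Finset.univ) fun τ _ => h τ
  refine hs.congr_left fun ω => ?_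
  rw [symmIntegral_eq_sum φ hf.continuousOn hsym hdeg (fun i => monic_endWeight _ _)]
  simp only [hφ, endWeight_mul, mul_sub, Finset.sum_apply, Finset.sum_sub_distrib]
  congr 1
  simp only [mul_left_comm _ ((ω : ℂ) ^ leadExp n)⁻¹, ← Finset.mul_sum]
  congr 1
  simp only [Finset.mul_sum]
  rw [Finset.sum_comm]
  refine Finset.sum_congr rfl fun ε _ => ?_
  rw [← Matrix.det_transpose, Matrix.det_apply', Finset.sum_mul, Finset.sum_mul]
  refine Finset.sum_congr rfl fun τ _ => ?_
  rw [Finset.prod_mul_distrib, exp_sum_eq_prod]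
  simp only [Matrix.transpose_apply, coefMatrix, Matrix.of_apply, vertex]
  ring

end Kissing

/-! ### Evaluation of the vertex determinants. -/

namespace Kissing

section Factorial

/-- Vandermonde's convolution for `(j+l).choose l`. Terms with `s > l` vanish, so the sum can run
over `Fin p`, which makes it the entry of a product of triangular matrices. -/
lemma add_factorial_eq_sum (p j l : ℕ) (hl : l < p) :
    ((j + l).factorial : ℂ) = ∑ s : Fin p,
      ((j.factorial : ℂ) * (j.choose s : ℂ)) * ((l.factorial : ℂ) * (l.choose s : ℂ)) := by
  have h1 : (j + l).choose l = ∑ s : Fin p, j.choose s * l.choose s := by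
    rw [Nat.add_choose_eq, Finset.Nat.sum_antidiagonal_eq_sum_range_succ_mk,
      Fin.sum_univ_eq_sum_range (fun s => j.choose s * l.choose s)]
    refine Finset.sum_subset_zero_on_sdiff (Finset.range_subset_range.2 hl) (fun s hs => ?_)
      fun s hs => ?_
    · simp only [Finset.mem_sdiff, Finset.mem_range] at hs
      rw [Nat.choose_eq_zero_of_lt (n := l) (by lia), mul_zero]
    · rw [Nat.choose_symm (by have := Finset.mem_range.1 hs; lia)]
  have h2 := Nat.add_choose_mul_factorial_mul_factorial j l
  rw [← h2, h1]
  push_cast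
  rw [Finset.sum_mul, Finset.sum_mul]
  exact Finset.sum_congr rfl fun s _ => by ring

/-- The Hankel determinant of the moments `k!` of the Laguerre weight. -/
lemma det_factorial (p : ℕ) :
    (Matrix.of fun j l : Fin p => (((j : ℕ) + (l : ℕ)).factorial : ℂ)).det =
      (∏ j ∈ Finset.range p, (j.factorial : ℂ)) ^ 2 := by
  set P : Matrix (Fin p) (Fin p) ℂ :=
    Matrix.of fun j s => (((j : ℕ).factorial : ℂ) * ((j : ℕ).choose s : ℂ)) with hP
  have h : (Matrix.of fun j l : Fin p => (((j : ℕ) + (l : ℕ)).factorial : ℂ)) =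
      P * P.transpose := by
    ext j l
    rw [Matrix.mul_apply, Matrix.of_apply, add_factorial_eq_sum p j l l.2]
    rfl
  have hdet : P.det = ∏ j ∈ Finset.range p, (j.factorial : ℂ) := by
    rw [Matrix.det_of_isLowerTriangular, ← Fin.prod_univ_eq_prod_range]
    · refine Finset.prod_congr rfl fun j _ => ?_
      simp [hP]
    · intro i j hij
      have hij' : i < j := hij
      simp [hP, Nat.choose_eq_zero_of_lt (show (i : ℕ) < j from hij')]
  rw [h, Matrix.det_mul, Matrix.det_transpose, hdet, sq]

lemma det_scaled_factorial (p : ℕ) (c u : ℂ) :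
    (Matrix.of fun j l : Fin p => c * u ^ ((j : ℕ) + (l : ℕ)) *
      (((j : ℕ) + (l : ℕ)).factorial : ℂ)).det =
      c ^ p * (u ^ (∑ j ∈ Finset.range p, j)) ^ 2 *
        (∏ j ∈ Finset.range p, (j.factorial : ℂ)) ^ 2 := by
  have h1 : (Matrix.of fun j l : Fin p => c * u ^ ((j : ℕ) + (l : ℕ)) *
      (((j : ℕ) + (l : ℕ)).factorial : ℂ)) =
      Matrix.of fun j l : Fin p => (c * u ^ (j : ℕ)) * Matrix.of (fun j l : Fin p =>
        u ^ (l : ℕ) * Matrix.of (fun j l : Fin p => (((j : ℕ) + (l : ℕ)).factorial : ℂ)) j l)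
          j l := by
    ext j l
    simp only [Matrix.of_apply, pow_add]
    ring
  rw [h1, Matrix.det_mul_column, Matrix.det_mul_row, det_factorial]
  simp only [Finset.prod_mul_distrib, Finset.prod_const, Finset.card_univ, Fintype.card_fin]
  rw [Fin.prod_univ_eq_prod_range (fun j => u ^ j), Finset.prod_pow_eq_pow_sum]
  ring

end Factorial

section Coef

variable {n : ℕ}

/-- For odd `k` the polynomial `φ_k` vanishes at `1` to one order more than at `-1`. Hence `φ_k φ_l`
has no leading contribution at `1` for any `l`, and the row is zero. -/
lemma det_coefMatrix_eq_zero_of_odd {ε : Fin n → Bool} {k : Fin n} (hk : Odd (k : ℕ))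
    (hε : ε k = true) : (coefMatrix ε).det = 0 := by
  refine Matrix.det_eq_zero_of_row_eq_zero k fun l => ?_
  obtain ⟨j, hj⟩ := hk
  have : ordOne k + ordOne l ≠ ordNegOne k + ordNegOne l := by
    simp only [ordOne, ordNegOne]; lia
  simp [coefMatrix, hε, endCoef, this]

/-- For even `k`, `φ_{k+1} = (x-1) φ_k`, and `x - 1 = -2` at the endpoint `-1`, so the two rows are
proportional. -/
lemma det_coefMatrix_eq_zero_of_even {ε : Fin n → Bool} {k k' : Fin n} (hk : Even (k : ℕ))
    (hk' : (k' : ℕ) = k + 1) (hε : ε k = false) (hε' : ε k' = false) :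
    (coefMatrix ε).det = 0 := by
  have hne : k' ≠ k := fun h => by rw [h] at hk'; lia
  obtain ⟨j, hj⟩ := hk
  have hrow : ∀ l, coefMatrix ε k' l = -2 * coefMatrix ε k l := by
    intro l
    have e1 : ordNegOne k' = ordNegOne k := by simp only [ordNegOne]; lia
    have e2 : ordOne k' = ordOne k + 1 := by simp only [ordOne]; lia
    simp only [coefMatrix, Matrix.of_apply, hε, hε', endCoef, cond_false, e1, e2, if_true]
    ring
  rw [← Matrix.det_updateRow_add_smul_self (coefMatrix ε) hne (2 : ℂ)]
  refine Matrix.det_eq_zero_of_row_eq_zero k' fun l => ?_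
  rw [Matrix.updateRow_self]
  simp [hrow]

/-- Signs of the vertex that contributes to the leading term: plus at even indices, minus at odd
ones. -/
def altSign (n : ℕ) : Fin n → Bool := fun k => decide (Even (k : ℕ))

/-- Even indices on the left, odd indices on the right. -/
def evenOddEquiv {p r : ℕ} (h : n = p + r) (h1 : r ≤ p) (h2 : p ≤ r + 1) :
    Fin p ⊕ Fin r ≃ Fin n where
  toFun := Sum.elim (fun j => ⟨2 * j, by lia⟩) (fun j => ⟨2 * j + 1, by lia⟩)
  invFun k := if hk : (k : ℕ) % 2 = 0 then Sum.inl ⟨k / 2, by lia⟩ else Sum.inr ⟨k / 2, by lia⟩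
  left_inv := by
    rintro (j | j)
    · simp
    · have : (2 * (j : ℕ) + 1) % 2 ≠ 0 := by lia
      exact (dif_neg this).trans (congrArg Sum.inr (Fin.ext
        (show (2 * (j : ℕ) + 1) / 2 = j by lia)))
  right_inv k := by
    by_cases hk : (k : ℕ) % 2 = 0
    · simp only [hk, dite_true, Sum.elim_inl]
      ext
      simp only
      lia
    · simp only [hk, dite_false, Sum.elim_inr]
      ext
      simp only
      lia

/-- Sort the indices by parity. An even row against an odd column vanishes at `1` to one order too
many, so the matrix is block triangular; the diagonal blocks are geometrically scaled Hankel
matrices of factorials. The bounds on `p` and `r` cover both parities of `n`. -/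
lemma det_coefMatrix_altSign {p r : ℕ} (h : n = p + r) (h1 : r ≤ p) (h2 : p ≤ r + 1) :
    (coefMatrix (altSign n)).det =
      ((-Complex.I) ^ p * ((2 * Complex.I) ^ (∑ j ∈ Finset.range p, j)) ^ 2 *
        (∏ j ∈ Finset.range p, (j.factorial : ℂ)) ^ 2) *
      ((4 * Complex.I) ^ r * ((-2 * Complex.I) ^ (∑ j ∈ Finset.range r, j)) ^ 2 *
        (∏ j ∈ Finset.range r, (j.factorial : ℂ)) ^ 2) := by
  set e := evenOddEquiv h h1 h2 with he
  have hl : ∀ j : Fin p, ((e (Sum.inl j) : Fin n) : ℕ) = 2 * j := fun j => rfl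
  have hr : ∀ j : Fin r, ((e (Sum.inr j) : Fin n) : ℕ) = 2 * j + 1 := fun j => rfl
  have hI : ∀ m : ℕ, (-1 : ℂ) ^ m / Complex.I ^ (m + 1) = -Complex.I * Complex.I ^ m := by
    intro m
    have : (-1 : ℂ) ^ m = Complex.I ^ m * Complex.I ^ m := by
      rw [← mul_pow, Complex.I_mul_I]
    rw [div_eq_iff (pow_ne_zero _ Complex.I_ne_zero), this, pow_succ]
    have := Complex.I_mul_I
    linear_combination (Complex.I ^ m * Complex.I ^ m) * this
  rw [← Matrix.det_submatrix_equiv_self e]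
  have hblock : (coefMatrix (altSign n)).submatrix e e = Matrix.fromBlocks
      (Matrix.of fun j l : Fin p => -Complex.I * (2 * Complex.I) ^ ((j : ℕ) + (l : ℕ)) *
        (((j : ℕ) + (l : ℕ)).factorial : ℂ)) 0
      (Matrix.of fun (j : Fin r) (l : Fin p) => coefMatrix (altSign n) (e (Sum.inr j))
        (e (Sum.inl l)))
      (Matrix.of fun j l : Fin r => 4 * Complex.I * (-2 * Complex.I) ^ ((j : ℕ) + (l : ℕ)) *
        (((j : ℕ) + (l : ℕ)).factorial : ℂ)) := by
    have e1 : ∀ m : ℕ, ordOne (2 * m) = m := fun m => by simp only [ordOne]; lia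
    have e2 : ∀ m : ℕ, ordNegOne (2 * m) = m := fun m => by simp only [ordNegOne]; lia
    have e3 : ∀ m : ℕ, ordOne (2 * m + 1) = m + 1 := fun m => by simp only [ordOne]; lia
    have e4 : ∀ m : ℕ, ordNegOne (2 * m + 1) = m := fun m => by simp only [ordNegOne]; lia
    ext (j | j) (l | l)
    · simp only [Matrix.submatrix_apply, Matrix.fromBlocks_apply₁₁, coefMatrix, Matrix.of_apply,
        altSign, hl, even_two_mul, decide_true, endCoef, cond_true, e1, e2, if_true, hI]
      ring
    · have : (j : ℕ) + (l + 1) ≠ j + l := by lia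
      simp only [Matrix.submatrix_apply, Matrix.fromBlocks_apply₁₂, coefMatrix, Matrix.of_apply,
        altSign, hl, hr, even_two_mul, decide_true, endCoef, cond_true, e1, e2, e3, e4, this,
        if_false, mul_zero, Matrix.zero_apply]
    · rfl
    · have hodd : ¬ Even (2 * (j : ℕ) + 1) := by simp
      simp only [Matrix.submatrix_apply, Matrix.fromBlocks_apply₂₂, coefMatrix, Matrix.of_apply,
        altSign, hr, hodd, decide_false, endCoef, cond_false, e3, e4, if_true, hI]
      ring
  rw [hblock, Matrix.det_fromBlocks_zero₁₂, det_scaled_factorial, det_scaled_factorial]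

lemma det_coefMatrix_altSign_ne_zero {p r : ℕ} (h : n = p + r) (h1 : r ≤ p) (h2 : p ≤ r + 1) :
    (coefMatrix (altSign n)).det ≠ 0 := by
  rw [det_coefMatrix_altSign h h1 h2]
  have hf : ∀ m : ℕ, (∏ j ∈ Finset.range m, (j.factorial : ℂ)) ≠ 0 := fun m =>
    Finset.prod_ne_zero_iff.2 fun j _ => by exact_mod_cast j.factorial_ne_zero
  have := Complex.I_ne_zero
  have := hf p
  have := hf r
  simp_all

lemma det_coefMatrix_altSign_odd (N : ℕ) :
    (coefMatrix (altSign (2 * N + 1))).det = -(Complex.I * (-1) ^ N) * oddConst N := by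
  rw [det_coefMatrix_altSign (p := N + 1) (r := N) (by lia) (by lia) (by lia)]
  have hsf : (∏ j ∈ Finset.range (N + 1), (j.factorial : ℂ)) = N.superFactorial := by
    rw [← Nat.prod_range_succ_factorial]; push_cast; rfl
  have hsf' : (∏ j ∈ Finset.range N, (j.factorial : ℂ)) = (N - 1).superFactorial := by
    cases N with
    | zero => simp
    | succ m => rw [← Nat.prod_range_succ_factorial]; push_cast; rfl
  have hS : N * (N + 1) = 2 * (∑ j ∈ Finset.range N, j) + 2 * N := by
    have := Finset.sum_range_id_mul_two (N + 1)
    rw [Finset.sum_range_succ] at this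
    simp only [Nat.add_sub_cancel] at this
    linarith
  rw [hsf, hsf', oddConst, hS, Finset.sum_range_succ]
  generalize (∑ j ∈ Finset.range N, j) = S
  have h4 : (4 : ℂ) = 2 ^ 2 := by norm_num
  -- `e1` collects the powers of `I`, `e2` those of `2`; here `S = 0 + ... + (N-1)`.
  have e1 : (-Complex.I) ^ (N + 1) * (Complex.I ^ (S + N)) ^ 2 * (Complex.I ^ N) *
      ((-Complex.I) ^ S) ^ 2 = -(Complex.I * (-1) ^ N) := by
    have a1 : (-Complex.I) ^ N * Complex.I ^ N = 1 := by
      rw [← mul_pow]; simp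
    have a2 : ((-Complex.I) ^ S) ^ 2 * (Complex.I ^ S) ^ 2 = 1 := by
      rw [← mul_pow, ← mul_pow]; simp
    have a3 : (Complex.I ^ N) ^ 2 = (-1) ^ N := by rw [← pow_mul, mul_comm, pow_mul, Complex.I_sq]
    rw [pow_succ, pow_add]
    linear_combination (-Complex.I * (Complex.I ^ N) ^ 2) * (((-Complex.I) ^ S) ^ 2 *
      (Complex.I ^ S) ^ 2 * a1 + a2) - Complex.I * a3
  have e2 : ((2 : ℂ) ^ (S + N)) ^ 2 * 4 ^ N * ((2 : ℂ) ^ S) ^ 2 = 4 ^ (2 * S + 2 * N) := by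
    rw [h4]
    simp only [← pow_mul, ← pow_add]
    congr 1
    ring
  have e3 : (-2 * Complex.I) = 2 * (-Complex.I) := by ring
  rw [← e1, ← e2, e3]
  simp only [mul_pow]
  ring

end Coef

end Kissing

/-! ### Which vertices contribute. -/

namespace Kissing

open MeasureTheory Filter Topology

section Vertices

variable {n : ℕ}

lemma mem_cube_of_mem_vertices {r : ℕ} {v : Fin n → ℝ} (hv : v ∈ vertices n r) : v ∈ cube n := by
  intro i
  rcases hv.1 i with h | h <;> rw [h] <;> simp

/-- A bijection between the positions of `-1` in `v` and in `w` extends to a permutation carrying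
one vertex to the other. -/
lemma IsSymmetricFun.eq_of_mem_vertices {f : (Fin n → ℝ) → ℂ} (hf : IsSymmetricFun f) {r : ℕ}
    {v w : Fin n → ℝ} (hv : v ∈ vertices n r) (hw : w ∈ vertices n r) : f v = f w := by
  classical
  have hcard : Fintype.card {i // v i = -1} = Fintype.card {i // w i = -1} := by
    rw [← Nat.card_eq_fintype_card, ← Nat.card_eq_fintype_card]
    exact hv.2.trans hw.2.symm
  set σ : Equiv.Perm (Fin n) := (Fintype.equivOfCardEq hcard).extendSubtype with hσ
  have : (fun i => w (σ i)) = v := by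
    ext i
    by_cases hi : v i = -1
    · rw [hi]
      exact Equiv.extendSubtype_mem (p := fun i => v i = -1) (q := fun i => w i = -1)
        (Fintype.equivOfCardEq hcard) i hi
    · rw [(hv.1 i).resolve_right hi]
      exact (hw.1 _).resolve_right (Equiv.extendSubtype_not_mem (p := fun i => v i = -1)
        (q := fun i => w i = -1) (Fintype.equivOfCardEq hcard) i hi)
  rw [← this]
  exact hf σ w (mem_cube_of_mem_vertices hw)

lemma sum_of_mem_vertices {r : ℕ} {v : Fin n → ℝ} (hv : v ∈ vertices n r) :
    ∑ k, v k = n - 2 * r := by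
  classical
  have h1 : ∀ k, v k = 1 - 2 * if v k = -1 then 1 else 0 := by
    intro k
    rcases hv.1 k with h | h <;> rw [h] <;> norm_num
  have h2 : (r : ℝ) = ∑ k, if v k = -1 then 1 else 0 := by
    rw [Finset.sum_boole, ← hv.2, Set.ncard_eq_toFinset_card']
    simp
  rw [Finset.sum_congr rfl fun k _ => h1 k, Finset.sum_sub_distrib, ← Finset.mul_sum, ← h2]
  simp

lemma neg_mem_vertices {r : ℕ} {v : Fin n → ℝ} (hv : v ∈ vertices n r) :
    -v ∈ vertices n (n - r) := by
  refine ⟨fun i => by rcases hv.1 i with h | h <;> simp [h], ?_⟩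
  have : {i | (-v) i = -1} = {i | v i = -1}ᶜ := by
    ext i
    rcases hv.1 i with h | h <;> norm_num [h]
  rw [this, Set.ncard_compl, hv.2]
  simp

lemma vertex_mem_vertices {r : ℕ} {ε : Fin n → Bool} (h : {k | ε k = false}.ncard = r) :
    vertex ε ∈ vertices n r := by
  refine ⟨fun i => by unfold vertex; cases ε i <;> simp, ?_⟩
  rw [← h]
  congr 1
  ext i
  cases hi : ε i <;> norm_num [vertex, hi]

/-- The alternating signs with the last one switched to minus. -/
def altSign' (N : ℕ) : Fin (2 * N + 1) → Bool :=
  Function.update (altSign (2 * N + 1)) (Fin.last (2 * N)) false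

lemma ncard_altSign (N : ℕ) : {k | altSign (2 * N + 1) k = false}.ncard = N := by
  have : {k | altSign (2 * N + 1) k = false} =
      (fun j : Fin N => (⟨2 * j + 1, by lia⟩ : Fin (2 * N + 1))) '' Set.univ := by
    ext k
    simp only [altSign, decide_eq_false_iff_not, Set.image_univ, Set.mem_range, Set.mem_ofPred_eq,
      Nat.not_even_iff_odd]
    constructor
    · rintro ⟨j, hj⟩
      exact ⟨⟨j, by have := k.2; lia⟩, Fin.ext hj.symm⟩
    · rintro ⟨j, rfl⟩
      exact ⟨j, rfl⟩
  rw [this, Set.ncard_image_of_injective, Set.ncard_univ, Nat.card_eq_fintype_card,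
    Fintype.card_fin]
  intro i j hij
  have := congrArg Fin.val hij
  simp only at this
  exact Fin.ext (by lia)

lemma altSign_last (N : ℕ) : altSign (2 * N + 1) (Fin.last (2 * N)) = true := by
  simp [altSign]

lemma ncard_altSign' (N : ℕ) : {k | altSign' N k = false}.ncard = N + 1 := by
  have : {k | altSign' N k = false} =
      insert (Fin.last (2 * N)) {k | altSign (2 * N + 1) k = false} := by
    ext k
    by_cases hk : k = Fin.last (2 * N)
    · simp [altSign', hk]
    · simp [altSign', hk]
  rw [this, Set.ncard_insert_of_notMem (by simp [altSign_last]), ncard_altSign]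

lemma altSign_ne_altSign' (N : ℕ) : altSign (2 * N + 1) ≠ altSign' N := by
  intro h
  have := congrFun h (Fin.last (2 * N))
  simp [altSign_last, altSign'] at this

/-- Odd indices are forced to minus first; then an even index with a successor is forced to plus.
Only a final even index stays free. -/
lemma eq_altSign_of_det_ne_zero {ε : Fin n → Bool} (h : (coefMatrix ε).det ≠ 0) (k : Fin n)
    (hk : Odd (k : ℕ) ∨ (k : ℕ) + 1 < n) : ε k = altSign n k := by
  have hodd : ∀ j : Fin n, Odd (j : ℕ) → ε j = false := fun j hj => by
    by_contra hε
    exact h (det_coefMatrix_eq_zero_of_odd hj (by simpa using hε))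
  rcases Nat.even_or_odd (k : ℕ) with he | ho
  · have hk' : (k : ℕ) + 1 < n := hk.resolve_left (Nat.not_odd_iff_even.2 he)
    have h2 := hodd ⟨k + 1, hk'⟩ he.add_one
    simp only [altSign, he, decide_true]
    by_contra hε
    exact h (det_coefMatrix_eq_zero_of_even (k' := ⟨k + 1, hk'⟩) he rfl (by simpa using hε) h2)
  · rw [hodd k ho]
    simp [altSign, ho]

lemma sum_coefMatrix_odd (N : ℕ) (F : (Fin (2 * N + 1) → Bool) → ℂ) :
    ∑ ε, (coefMatrix ε).det * F ε =
      (coefMatrix (altSign (2 * N + 1))).det * F (altSign (2 * N + 1)) +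
        (coefMatrix (altSign' N)).det * F (altSign' N) := by
  refine Fintype.sum_eq_add _ _ (altSign_ne_altSign' N) fun ε hε => ?_
  by_contra h0
  have hdet : (coefMatrix ε).det ≠ 0 := fun h => h0 (by rw [h, zero_mul])
  have heq : ∀ k, k ≠ Fin.last (2 * N) → ε k = altSign (2 * N + 1) k := fun k hk =>
    eq_altSign_of_det_ne_zero hdet k (Or.inr (by
      have h1 := k.2
      have h2 : (k : ℕ) ≠ 2 * N := fun h => hk (Fin.ext h)
      lia))
  cases hl : ε (Fin.last (2 * N)) with
  | true =>
    refine hε.1 (funext fun k => ?_)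
    by_cases hk : k = Fin.last (2 * N)
    · rw [hk, hl, altSign_last]
    · exact heq k hk
  | false =>
    refine hε.2 (funext fun k => ?_)
    by_cases hk : k = Fin.last (2 * N)
    · rw [hk, hl, altSign', Function.update_self]
    · rw [heq k hk, altSign', Function.update_of_ne hk]

/-- The last index is odd here, so no sign is free. Having a single surviving exponential is what
keeps `h_{2N+1}` away from zero. -/
lemma sum_coefMatrix_even (N : ℕ) (F : (Fin (2 * N + 2) → Bool) → ℂ) :
    ∑ ε, (coefMatrix ε).det * F ε =
      (coefMatrix (altSign (2 * N + 2))).det * F (altSign (2 * N + 2)) := by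
  refine Fintype.sum_eq_single _ fun ε hε => ?_
  by_contra h0
  have hdet : (coefMatrix ε).det ≠ 0 := fun h => h0 (by rw [h, zero_mul])
  refine hε (funext fun k => eq_altSign_of_det_ne_zero hdet k ?_)
  rcases Nat.even_or_odd (k : ℕ) with he | ho
  · right
    obtain ⟨j, hj⟩ := he
    have := k.2
    lia
  · exact Or.inl ho

end Vertices

lemma leadExp_odd (N : ℕ) : leadExp (2 * N + 1) = 2 * N * (N + 1) + 1 := by
  rw [leadExp, Fin.sum_univ_eq_sum_range fun k => 2 * ordNegOne k + 1]
  induction N with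
  | zero => simp [ordNegOne]
  | succ N ih =>
    rw [show 2 * (N + 1) + 1 = 2 * N + 1 + 1 + 1 by ring, Finset.sum_range_succ,
      Finset.sum_range_succ, ih]
    have h1 : ordNegOne (2 * N + 1) = N := by simp only [ordNegOne]; lia
    have h2 : ordNegOne (2 * N + 1 + 1) = N + 1 := by simp only [ordNegOne]; lia
    rw [h1, h2]
    ring

/-- Leading asymptotics of `I_{2N+1}[f]`, with the coefficients still as determinants. -/
theorem isBigO_symmIntegral_odd {N : ℕ} {f : (Fin (2 * N + 1) → ℝ) → ℂ}
    (hf : ContDiffOn ℝ ((⊤ : ℕ∞) : WithTop ℕ∞) f (cube (2 * N + 1))) (hsym : IsSymmetricFun f)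
    {v₁ v₂ : Fin (2 * N + 1) → ℝ} (hv₁ : v₁ ∈ vertices (2 * N + 1) N)
    (hv₂ : v₂ ∈ vertices (2 * N + 1) (N + 1)) :
    (fun ω : ℝ => symmIntegral (2 * N + 1) f ω - ((ω : ℂ) ^ (2 * N * (N + 1) + 1))⁻¹ *
        ((coefMatrix (altSign (2 * N + 1))).det * (Complex.exp (Complex.I * ω) * f v₁) +
          (coefMatrix (altSign' N)).det * (Complex.exp (-(Complex.I * ω)) * f v₂)))
      =O[atTop] fun ω : ℝ => (ω ^ (2 * N * (N + 1) + 2))⁻¹ := by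
  have h := isBigO_symmIntegral hf hsym
  have m₁ := vertex_mem_vertices (ncard_altSign N)
  have m₂ := vertex_mem_vertices (ncard_altSign' N)
  simp only [leadExp_odd, mul_assoc (Matrix.det _), sum_coefMatrix_odd] at h
  rw [hsym.eq_of_mem_vertices m₁ hv₁, hsym.eq_of_mem_vertices m₂ hv₂, sum_of_mem_vertices m₁,
    sum_of_mem_vertices m₂] at h
  refine h.congr_left fun ω => ?_
  push_cast
  ring_nf

/-! ### Hankel determinants and orthogonal polynomials. -/

section Hankel

/-- Heine's formula: the Hankel determinant is `I_{m+1}[1]`. -/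
lemma hankelDet_eq_symmIntegral (m : ℕ) (ω : ℝ) :
    hankelDet m ω = symmIntegral (m + 1) (fun _ => 1) ω := by
  rw [symmIntegral_eq_sum (fun k : Fin (m + 1) => (Polynomial.X ^ (k : ℕ) : Polynomial ℝ))
    continuousOn_const (fun _ _ _ => rfl) (fun i => Polynomial.natDegree_X_pow _)
    (fun i => Polynomial.monic_X_pow _), hankelDet, ← Matrix.det_transpose, Matrix.det_apply']
  refine Finset.sum_congr rfl fun τ _ => ?_
  congr 1
  simp only [one_mul]
  rw [integral_cube_prod (fun k y => (((Polynomial.X ^ (k : ℕ) * Polynomial.X ^ (τ k : ℕ) :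
    Polynomial ℝ).eval y : ℝ) : ℂ) * Complex.exp (Complex.I * ω * y))]
  refine Finset.prod_congr rfl fun k _ => ?_
  simp [moment, pow_add]

lemma conj_moment (k : ℕ) (ω : ℝ) :
    (starRingEnd ℂ) (moment k ω) = (-1) ^ k * moment k ω := by
  have h := intervalIntegral.integral_comp_neg (a := -1) (b := 1) fun x : ℝ =>
    (-1 : ℂ) ^ k * ((x : ℂ) ^ k * Complex.exp (Complex.I * (ω : ℂ) * (x : ℂ)))
  rw [neg_neg] at h
  rw [moment, ← intervalIntegral.integral_const_mul, ← h,
    intervalIntegral.integral_of_le (by norm_num), ← integral_conj,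
    intervalIntegral.integral_of_le (by norm_num)]
  refine integral_congr_ae (Eventually.of_forall fun x => ?_)
  simp only [map_mul, map_pow, Complex.conj_ofReal, ← Complex.exp_conj, Complex.conj_I,
    Complex.ofReal_neg]
  rw [← mul_assoc, ← mul_pow]
  ring_nf

/-- Conjugation multiplies entry `(i,j)` by `(-1)^(i+j)`; the row signs and the column signs cancel
in the determinant. Reality serves both to find the second leading coefficient and to apply the
intermediate value theorem. -/
lemma conj_hankelDet (m : ℕ) (ω : ℝ) : (starRingEnd ℂ) (hankelDet m ω) = hankelDet m ω := by
  have h1 : (Matrix.of fun i j : Fin (m + 1) => moment ((i : ℕ) + (j : ℕ)) ω).map (starRingEnd ℂ) =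
      Matrix.of fun i j : Fin (m + 1) => (-1) ^ (i : ℕ) * Matrix.of (fun i j : Fin (m + 1) =>
        (-1) ^ (j : ℕ) * (Matrix.of fun i j : Fin (m + 1) => moment ((i : ℕ) + (j : ℕ)) ω) i j)
          i j := by
    ext i j
    simp only [Matrix.map_apply, Matrix.of_apply, conj_moment, pow_add]
    ring
  rw [hankelDet, RingHom.map_det, RingHom.mapMatrix_apply, h1, Matrix.det_mul_column,
    Matrix.det_mul_row, ← mul_assoc, ← Finset.prod_mul_distrib]
  simp [← mul_pow]

lemma continuous_moment (k : ℕ) : Continuous (moment k) := by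
  unfold moment
  refine intervalIntegral.continuous_parametric_intervalIntegral_of_continuous' ?_ _ _
  fun_prop

lemma continuous_hankelDet (m : ℕ) : Continuous (hankelDet m) := by
  unfold hankelDet
  refine Continuous.matrix_det (continuous_matrix fun i j => ?_)
  exact continuous_moment _

lemma sum_coeff_mul_moment {n : ℕ} {ω : ℝ} {p : Polynomial ℂ} (hp : p.natDegree = n) (k : ℕ) :
    ∫ x in (-1 : ℝ)..1, p.eval (x : ℂ) * (x : ℂ) ^ k * Complex.exp (Complex.I * (ω : ℂ) * (x : ℂ)) =
      ∑ j ∈ Finset.range (n + 1), p.coeff j * moment (k + j) ω := by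
  simp only [moment, ← intervalIntegral.integral_const_mul]
  rw [← intervalIntegral.integral_finsetSum
    fun j _ => Continuous.intervalIntegrable (by fun_prop) _ _]
  refine intervalIntegral.integral_congr fun x _ => ?_
  simp only [Polynomial.eval_eq_sum_range, hp, Finset.sum_mul, pow_add]
  exact Finset.sum_congr rfl fun j _ => by ring

/-- If `h_m` vanishes although there is a monic orthogonal polynomial of degree `m + 1`, then
`h_{m+1}` vanishes as well. -/
lemma hankelDet_succ_eq_zero {m : ℕ} {ω : ℝ} (h : hankelDet m ω = 0) {p : Polynomial ℂ}
    (hp : IsMonicOP (m + 1) ω p) : hankelDet (m + 1) ω = 0 := by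
  obtain ⟨hmon, hdeg, horth⟩ := hp
  obtain ⟨q, hq, hqM⟩ := Matrix.exists_vecMul_eq_zero_iff.2 h
  have hq' : ∀ j ≤ m, ∑ i : Fin (m + 1), q i * moment ((i : ℕ) + j) ω = 0 := fun j hj =>
    congrFun hqM ⟨j, by lia⟩
  -- Orthogonality of `p` writes the moments of column `m+1`, in rows `0` to `m`, through the
  -- earlier columns, which `q` annihilates. So `q` padded with a zero is in the left kernel of the
  -- larger matrix.
  have hlast : ∑ i : Fin (m + 1), q i * moment ((i : ℕ) + (m + 1)) ω = 0 := by
    have hmom : ∀ i : Fin (m + 1), moment ((i : ℕ) + (m + 1)) ω =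
        -∑ j ∈ Finset.range (m + 1), p.coeff j * moment ((i : ℕ) + j) ω := by
      intro i
      have := horth i i.2
      rw [sum_coeff_mul_moment hdeg, Finset.sum_range_succ] at this
      have hc : p.coeff (m + 1) = 1 := by rw [← hdeg]; exact hmon
      rw [hc, one_mul] at this
      exact eq_neg_of_add_eq_zero_right this
    simp only [hmom, mul_neg, Finset.sum_neg_distrib, Finset.mul_sum]
    rw [Finset.sum_comm, neg_eq_zero]
    refine Finset.sum_eq_zero fun j hj => ?_
    simp only [mul_left_comm _ (p.coeff j)]
    rw [← Finset.mul_sum, hq' j (by have := Finset.mem_range.1 hj; lia), mul_zero]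
  refine Matrix.exists_vecMul_eq_zero_iff.1
    ⟨Fin.snoc (α := fun _ => ℂ) q 0, fun h0 => hq (funext fun i => ?_), funext fun j => ?_⟩
  · have := congrFun h0 i.castSucc
    simpa using this
  · rw [Matrix.vecMul, dotProduct, Fin.sum_univ_castSucc]
    simp only [Fin.snoc_castSucc, Fin.snoc_last,
      zero_mul, add_zero, Matrix.of_apply, Fin.val_castSucc, Pi.zero_apply]
    rcases Nat.lt_succ_iff_lt_or_eq.1 j.2 with hj | hj
    · exact hq' j (by lia)
    · rw [hj]; exact hlast

end Hankel

end Kissing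

/-! ### The second coefficient and the final asymptotics. -/

namespace Kissing

open MeasureTheory Filter Topology

/-- A bound `g(ω) - ω^{-E} M(ω) = O(ω^{-E-1})` says that `ω^E g(ω) - M(ω) = O(ω⁻¹)`. -/
lemma exists_bound_pow_mul_sub {g M : ℝ → ℂ} {E : ℕ}
    (h : (fun ω : ℝ => g ω - ((ω : ℂ) ^ E)⁻¹ * M ω) =O[atTop] fun ω : ℝ => (ω ^ (E + 1))⁻¹) :
    ∃ B : ℝ, 0 < B ∧ ∀ᶠ ω : ℝ in atTop, ‖(ω : ℂ) ^ E * g ω - M ω‖ ≤ B / ω := by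
  obtain ⟨B, hB, hb⟩ := h.exists_pos
  refine ⟨B, hB, ?_⟩
  filter_upwards [hb.bound, eventually_gt_atTop (0 : ℝ)] with ω h1 h0
  have hω : (ω : ℂ) ^ E ≠ 0 := pow_ne_zero _ (by exact_mod_cast h0.ne')
  have : (ω : ℂ) ^ E * g ω - M ω = (ω : ℂ) ^ E * (g ω - ((ω : ℂ) ^ E)⁻¹ * M ω) := by
    rw [mul_sub, mul_inv_cancel_left₀ hω]
  rw [this, norm_mul, norm_pow, Complex.norm_real, Real.norm_of_nonneg h0.le]
  rw [Real.norm_of_nonneg (by positivity)] at h1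
  refine (mul_le_mul_of_nonneg_left h1 (by positivity)).trans (le_of_eq ?_)
  rw [pow_succ]
  field_simp

lemma tendsto_pow_mul_sub {g M : ℝ → ℂ} {E : ℕ}
    (h : (fun ω : ℝ => g ω - ((ω : ℂ) ^ E)⁻¹ * M ω) =O[atTop] fun ω : ℝ => (ω ^ (E + 1))⁻¹) :
    Tendsto (fun ω : ℝ => (ω : ℂ) ^ E * g ω - M ω) atTop (𝓝 0) := by
  obtain ⟨B, -, hb⟩ := exists_bound_pow_mul_sub h
  exact squeeze_zero_norm' hb (tendsto_const_nhds.div_atTop tendsto_id)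

lemma hankelDet_isBigO_of_vertices (N : ℕ) :
    (fun ω : ℝ => hankelDet (2 * N) ω - ((ω : ℂ) ^ (2 * N * (N + 1) + 1))⁻¹ *
        ((coefMatrix (altSign (2 * N + 1))).det * Complex.exp (Complex.I * ω) +
          (coefMatrix (altSign' N)).det * Complex.exp (-(Complex.I * ω))))
      =O[atTop] fun ω : ℝ => (ω ^ (2 * N * (N + 1) + 2))⁻¹ := by
  have := isBigO_symmIntegral_odd (N := N) (f := fun _ => 1) contDiffOn_const (fun _ _ _ => rfl)
    (vertex_mem_vertices (ncard_altSign N)) (vertex_mem_vertices (ncard_altSign' N))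
  simpa only [mul_one, ← hankelDet_eq_symmIntegral] using this

/-- Along `ω = 2πk` the limit gives `Z - conj Z = 0`; along `ω = 2πk + π/2` it gives `Z + conj Z =
0`. -/
lemma eq_zero_of_tendsto_exp {Z : ℂ}
    (h : Tendsto (fun ω : ℝ => Z * Complex.exp (Complex.I * ω) -
      (starRingEnd ℂ) Z * Complex.exp (-(Complex.I * ω))) atTop (𝓝 0)) : Z = 0 := by
  have hk : Tendsto (fun k : ℕ => (k : ℝ) * (2 * Real.pi)) atTop atTop :=
    tendsto_natCast_atTop_atTop.atTop_mul_const (by positivity)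
  have e1 : ∀ k : ℕ, Complex.exp (Complex.I * (((k : ℝ) * (2 * Real.pi) : ℝ) : ℂ)) = 1 := by
    intro k
    rw [← Complex.exp_nat_mul_two_pi_mul_I k]
    congr 1
    push_cast
    ring
  have e2 : Complex.exp (Complex.I * ((Real.pi / 2 : ℝ) : ℂ)) = Complex.I := by
    rw [mul_comm]
    push_cast
    exact Complex.exp_pi_div_two_mul_I
  have t1 := h.comp hk
  have t2 := h.comp (tendsto_atTop_add_const_right _ (Real.pi / 2) hk)
  have c1 : Z - (starRingEnd ℂ) Z = 0 := by
    refine tendsto_nhds_unique (tendsto_const_nhds.congr fun k => ?_) t1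
    simp only [Function.comp_apply, Complex.exp_neg, e1]
    simp
  have c2 : Complex.I * (Z + (starRingEnd ℂ) Z) = 0 := by
    refine tendsto_nhds_unique (tendsto_const_nhds.congr fun k => ?_) t2
    simp only [Function.comp_apply, Complex.exp_neg, Complex.ofReal_add _ (Real.pi / 2), mul_add,
      Complex.exp_add, e1, e2]
    simp
    ring
  have c3 := (mul_eq_zero.1 c2).resolve_left Complex.I_ne_zero
  have : 2 * Z = 0 := by linear_combination c1 + c3
  simpa using this

/-- Since the Hankel determinant is real, its two leading coefficients are conjugate. -/
lemma det_coefMatrix_altSign' (N : ℕ) :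
    (coefMatrix (altSign' N)).det = Complex.I * (-1) ^ N * oddConst N := by
  set A := (coefMatrix (altSign (2 * N + 1))).det with hA
  set B := (coefMatrix (altSign' N)).det with hB
  have ht := tendsto_pow_mul_sub (hankelDet_isBigO_of_vertices N)
  have ht' := (Complex.continuous_conj.tendsto 0).comp ht
  rw [map_zero] at ht'
  -- Subtracting the conjugate asymptotics removes the real `h_{2N}` and leaves only the
  -- exponentials, with `Z = conj B - A`.
  have hZ : (starRingEnd ℂ) B - A = 0 := by
    refine eq_zero_of_tendsto_exp ?_
    have := ht.sub ht'
    rw [sub_zero] at this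
    refine this.congr fun ω => ?_
    simp only [Function.comp_apply, map_sub, map_mul, map_add, map_pow, Complex.conj_ofReal,
      conj_hankelDet, ← Complex.exp_conj, Complex.conj_I, map_neg, Complex.conj_conj, neg_mul,
      neg_neg, ← hA, ← hB]
    ring
  have hBA : B = (starRingEnd ℂ) A := by
    rw [← sub_eq_zero.1 hZ, Complex.conj_conj]
  have h4 : (starRingEnd ℂ) 4 = 4 := Complex.conj_ofNat 4
  rw [hBA, hA, det_coefMatrix_altSign_odd, oddConst]
  simp [h4]

/-- Leading asymptotics of `I_{2N+1}[f]` for symmetric `f`. -/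
theorem symmIntegral_odd_isBigO {N : ℕ} {f : (Fin (2 * N + 1) → ℝ) → ℂ}
    (hf : ContDiffOn ℝ ((⊤ : ℕ∞) : WithTop ℕ∞) f (cube (2 * N + 1))) (hsym : IsSymmetricFun f)
    {v₁ v₂ : Fin (2 * N + 1) → ℝ} (hv₁ : v₁ ∈ vertices (2 * N + 1) N)
    (hv₂ : v₂ ∈ vertices (2 * N + 1) (N + 1)) :
    (fun ω : ℝ => symmIntegral (2 * N + 1) f ω -
            (-(Complex.I * (-1) ^ N / (ω : ℂ) ^ (2 * N * (N + 1) + 1)) * oddConst N *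
              (Complex.exp (Complex.I * (ω : ℂ)) * f v₁ -
                Complex.exp (-(Complex.I * (ω : ℂ))) * f v₂)))
      =O[atTop] fun ω : ℝ => (ω ^ (2 * N * (N + 1) + 2))⁻¹ := by
  refine (isBigO_symmIntegral_odd hf hsym hv₁ hv₂).congr_left fun ω => ?_
  rw [det_coefMatrix_altSign_odd, det_coefMatrix_altSign']
  ring

lemma exp_sub_exp_neg (ω : ℝ) : Complex.exp (Complex.I * (ω : ℂ)) -
    Complex.exp (-(Complex.I * (ω : ℂ))) = 2 * Complex.I * ((Real.sin ω : ℝ) : ℂ) := by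
  rw [Complex.ofReal_sin, mul_right_comm, Complex.two_sin, mul_comm Complex.I (ω : ℂ), mul_assoc,
    Complex.I_mul_I, neg_mul]
  ring

/-- Leading asymptotics of `I_{2N+1}[f]` for even symmetric `f`. -/
theorem symmIntegral_odd_isBigO_of_even {N : ℕ} {f : (Fin (2 * N + 1) → ℝ) → ℂ}
    (hf : ContDiffOn ℝ ((⊤ : ℕ∞) : WithTop ℕ∞) f (cube (2 * N + 1))) (hsym : IsSymmetricFun f)
    (heven : IsEvenFun f) {v : Fin (2 * N + 1) → ℝ} (hv : v ∈ vertices (2 * N + 1) N) :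
    (fun ω : ℝ => symmIntegral (2 * N + 1) f ω -
            2 * (-1) ^ N / (ω : ℂ) ^ (2 * N * (N + 1) + 1) * oddConst N *
              f v * ((Real.sin ω : ℝ) : ℂ))
      =O[atTop] fun ω : ℝ => (ω ^ (2 * N * (N + 1) + 2))⁻¹ := by
  have hv₂ : -v ∈ vertices (2 * N + 1) (N + 1) := by
    have := neg_mem_vertices hv
    rwa [show 2 * N + 1 - N = N + 1 by lia] at this
  refine (symmIntegral_odd_isBigO hf hsym hv hv₂).congr_left fun ω => ?_
  rw [heven v (mem_cube_of_mem_vertices hv), ← sub_mul, exp_sub_exp_neg]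
  have := Complex.I_mul_I
  congr 1
  linear_combination (-2 * (-1) ^ N / (ω : ℂ) ^ (2 * N * (N + 1) + 1) * oddConst N *
              f v * ((Real.sin ω : ℝ) : ℂ)) * this

/-- Leading asymptotics of `h_{2N}`. -/
theorem hankelDet_isBigO (N : ℕ) : (fun ω : ℝ => hankelDet (2 * N) ω -
        2 * (-1) ^ N / (ω : ℂ) ^ (2 * N * (N + 1) + 1) * oddConst N * ((Real.sin ω : ℝ) : ℂ))
      =O[atTop] fun ω : ℝ => (ω ^ (2 * N * (N + 1) + 2))⁻¹ := by
  have := symmIntegral_odd_isBigO_of_even (N := N) (f := fun _ => 1) contDiffOn_const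
    (fun _ _ _ => rfl) (fun _ _ => rfl) (vertex_mem_vertices (ncard_altSign N))
  simpa only [mul_one, ← hankelDet_eq_symmIntegral] using this

/-- The Hankel determinants of even size do not vanish for large `ω`. -/
theorem eventually_hankelDet_odd_ne_zero (N : ℕ) :
    ∀ᶠ ω : ℝ in atTop, hankelDet (2 * N + 1) ω ≠ 0 := by
  have h := isBigO_symmIntegral (n := 2 * N + 2) (f := fun _ => 1) contDiffOn_const
    (fun _ _ _ => rfl)
  simp only [mul_one, sum_coefMatrix_even] at h
  have ht := tendsto_pow_mul_sub h
  have hne : 0 < ‖(coefMatrix (altSign (2 * N + 2))).det‖ := norm_pos_iff.2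
    (det_coefMatrix_altSign_ne_zero (p := N + 1) (r := N + 1) (by lia) le_rfl (by lia))
  -- At a zero the normalised error would have norm exactly that of the determinant, because the
  -- exponential has modulus one.
  filter_upwards [ht.norm.eventually_lt_const (by rwa [norm_zero])] with ω hω h0
  rw [← hankelDet_eq_symmIntegral, h0, mul_zero, zero_sub, norm_neg, norm_mul, mul_assoc,
    ← Complex.ofReal_mul, mul_comm Complex.I, Complex.norm_exp_ofReal_mul_I, mul_one] at hω
  exact lt_irrefl _ hω

lemma oddConst_eq (N : ℕ) : ∃ K : ℝ, 0 < K ∧ oddConst N = K := by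
  refine ⟨4 ^ (N * (N + 1)) * ((N - 1).superFactorial : ℝ) ^ 2 * (N.superFactorial : ℝ) ^ 2, ?_, ?_⟩
  · have h : ∀ m : ℕ, (0 : ℝ) < m.superFactorial := fun m => by
      rw [← Nat.prod_range_succ_factorial]
      exact_mod_cast Finset.prod_pos fun i _ => Nat.factorial_pos i
    have := h N
    have := h (N - 1)
    positivity
  · simp [oddConst]

/-! ### Location of the zeros. -/

/-- The Hankel determinant normalized so that it approaches `sin ω`. -/
lemma exists_normalized_hankelDet (N : ℕ) : ∃ (H : ℝ → ℝ) (B W : ℝ), Continuous H ∧ 0 < B ∧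
    ∀ ω ≥ W, (hankelDet (2 * N) ω = 0 ↔ H ω = 0) ∧ |H ω - Real.sin ω| ≤ B / ω := by
  obtain ⟨K, hK, hKe⟩ := oddConst_eq N
  set E := 2 * N * (N + 1) + 1 with hE
  set κ : ℝ := 2 * (-1) ^ N * K with hκ
  have hκ0 : κ ≠ 0 := by simp [hκ, hK.ne']
  have hbig := hankelDet_isBigO N
  rw [hKe] at hbig
  obtain ⟨B, hB, hb⟩ := exists_bound_pow_mul_sub (g := hankelDet (2 * N))
    (M := fun ω => ((κ * Real.sin ω : ℝ) : ℂ)) (E := E) (hbig.congr_left fun ω => by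
      rw [hκ]; push_cast; ring)
  obtain ⟨W, hW⟩ := eventually_atTop.1 hb
  refine ⟨fun ω => ω ^ E * (hankelDet (2 * N) ω).re / κ, B / |κ|, max W 1, ?_,
    by positivity, fun ω hω => ⟨?_, ?_⟩⟩
  · have := Complex.continuous_re.comp (continuous_hankelDet (2 * N))
    exact ((continuous_id.pow E).mul this).div_const κ
  · have hω0 : ω ≠ 0 := by have := le_of_max_le_right hω; positivity
    have him := Complex.conj_eq_iff_im.1 (conj_hankelDet (2 * N) ω)
    rw [Complex.ext_iff]
    simp [him, hω0, hκ0]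
  · have hω0 : 0 < ω := by have := le_of_max_le_right hω; positivity
    have h1 := hW ω (le_of_max_le_left hω)
    have h2 := (Complex.abs_re_le_norm _).trans h1
    have h3 : ((ω : ℂ) ^ E * hankelDet (2 * N) ω - ((κ * Real.sin ω : ℝ) : ℂ)).re =
        ω ^ E * (hankelDet (2 * N) ω).re - κ * Real.sin ω := by
      rw [Complex.sub_re, Complex.ofReal_re, ← Complex.ofReal_pow, Complex.re_ofReal_mul]
    rw [h3] at h2
    have h4 : ω ^ E * (hankelDet (2 * N) ω).re / κ - Real.sin ω =
        (ω ^ E * (hankelDet (2 * N) ω).re - κ * Real.sin ω) / κ := by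
      field_simp
    rw [h4, abs_div, div_le_iff₀ (abs_pos.2 hκ0)]
    refine h2.trans (le_of_eq ?_)
    have := abs_pos.2 hκ0
    field_simp

/-- A continuous function that approaches `sin` at rate `1/ω` has zeros near the large multiples
of `π`. -/
lemma exists_zero_near_mul_pi {H : ℝ → ℝ} {B W : ℝ} (hH : Continuous H) (hB : 0 < B)
    (h : ∀ ω ≥ W, |H ω - Real.sin ω| ≤ B / ω) {k : ℕ} (hkW : W ≤ k) (hk1 : 1 ≤ (k : ℝ))
    (hkB : 2 * B ≤ k) : ∃ ω : ℝ, (k : ℝ) ≤ ω ∧ |ω - k * Real.pi| ≤ 2 * B / k ∧ H ω = 0 := by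
  have hk0 : 0 < (k : ℝ) := by linarith
  set δ : ℝ := 2 * B / k with hδ
  have hδ0 : 0 < δ := by positivity
  have hδ1 : δ ≤ 1 := (div_le_one hk0).2 hkB
  have hpi := Real.pi_gt_three
  have hpi4 := Real.pi_lt_four
  -- Jordan's inequality gives `sin δ ≥ 2δ/π = 4B/(πk)`, which exceeds `B/k` since `π < 4`. The
  -- error then cannot change the sign of `sin` at `kπ ± δ`.
  have hsin : B / k < Real.sin δ := by
    have h1 := Real.mul_le_sin hδ0.le (by linarith)
    refine lt_of_lt_of_le ?_ h1
    rw [hδ, mul_div_assoc', div_lt_div_iff_of_pos_right hk0, div_mul_eq_mul_div,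
      lt_div_iff₀ Real.pi_pos]
    nlinarith
  set s : ℝ := (-1) ^ k with hs
  have hs2 : s * s = 1 := by rw [hs, ← mul_pow]; simp
  have hsabs : |s| = 1 := by rw [hs, abs_pow]; simp
  -- The whole interval lies beyond `k`, so the error there is at most `B/k`.
  have ha : (k : ℝ) ≤ k * Real.pi - δ := by nlinarith
  have hb : (k : ℝ) ≤ k * Real.pi + δ := by nlinarith
  have hest : ∀ x : ℝ, (k : ℝ) ≤ x → |s * H x - s * Real.sin x| ≤ B / k := by
    intro x hx
    rw [← mul_sub, abs_mul, hsabs, one_mul]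
    exact (h x (hkW.trans hx)).trans (by gcongr)
  have hsa : s * Real.sin (k * Real.pi - δ) = -Real.sin δ := by
    rw [sub_eq_add_neg, add_comm, Real.sin_add_nat_mul_pi, ← mul_assoc, hs2, one_mul, Real.sin_neg]
  have hsb : s * Real.sin (k * Real.pi + δ) = Real.sin δ := by
    rw [add_comm, Real.sin_add_nat_mul_pi, ← mul_assoc, hs2, one_mul]
  have h1 := hest _ ha
  have h2 := hest _ hb
  rw [hsa, abs_le] at h1
  rw [hsb, abs_le] at h2
  obtain ⟨ω, hω, hω0⟩ := intermediate_value_Icc (show k * Real.pi - δ ≤ k * Real.pi + δ by linarith)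
    (show Continuous fun x => s * H x from continuous_const.mul hH).continuousOn
    (show (0 : ℝ) ∈ Set.Icc (s * H (k * Real.pi - δ)) (s * H (k * Real.pi + δ)) from
      ⟨by linarith, by linarith⟩)
  refine ⟨ω, ha.trans hω.1, abs_le.2 ⟨by linarith [hω.1], by linarith [hω.2]⟩, ?_⟩
  have hs0 : s ≠ 0 := by rw [hs]; simp
  exact (mul_eq_zero.1 hω0).resolve_left hs0

/-- Points where `sin` is at most `B/ω` are within `2B/ω` of the multiples of `π`. -/
lemma exists_nat_mul_pi_near {B ω : ℝ} (hω : 0 < ω) (h : |Real.sin ω| ≤ B / ω) :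
    ∃ k : ℕ, |ω - k * Real.pi| ≤ 2 * B / ω := by
  have hpi := Real.pi_pos
  -- The nearest multiple of `π`, at distance at most `π/2`, where Jordan's inequality applies.
  refine ⟨⌊ω / Real.pi + 1 / 2⌋₊, ?_⟩
  set k := ⌊ω / Real.pi + 1 / 2⌋₊ with hk
  have h1 := Nat.floor_le (show 0 ≤ ω / Real.pi + 1 / 2 by positivity)
  have h2 := Nat.lt_floor_add_one (ω / Real.pi + 1 / 2)
  rw [← hk] at h1 h2
  have hx : |ω - k * Real.pi| ≤ Real.pi / 2 := by
    have e : ω = ω / Real.pi * Real.pi := by field_simp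
    rw [abs_le]
    constructor <;> nlinarith
  have h3 := Real.mul_abs_le_abs_sin hx
  rw [Real.sin_sub_nat_mul_pi, abs_mul, abs_pow, abs_neg, abs_one, one_pow, one_mul] at h3
  have h4 := h3.trans h
  rw [div_mul_eq_mul_div, div_le_iff₀ hpi] at h4
  have hB : 0 ≤ B / ω := (abs_nonneg _).trans h
  have := Real.pi_lt_four
  rw [mul_div_assoc]
  nlinarith

end Kissing

theorem mainTheorem3 (N : ℕ) :
    -- leading order asymptotics of `I_{2N+1}[f]`, in general and for even `f`
    (∀ f : (Fin (2 * N + 1) → ℝ) → ℂ,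
      ContDiffOn ℝ ((⊤ : ℕ∞) : WithTop ℕ∞) f (Kissing.cube (2 * N + 1)) →
      Kissing.IsSymmetricFun f →
      ∀ v₁ ∈ Kissing.vertices (2 * N + 1) N, ∀ v₂ ∈ Kissing.vertices (2 * N + 1) (N + 1),
      f v₁ ≠ 0 → f v₂ ≠ 0 →
        ((fun ω : ℝ => Kissing.symmIntegral (2 * N + 1) f ω -
            (-(Complex.I * (-1) ^ N / (ω : ℂ) ^ (2 * N * (N + 1) + 1)) * Kissing.oddConst N *
              (Complex.exp (Complex.I * (ω : ℂ)) * f v₁ -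
                Complex.exp (-(Complex.I * (ω : ℂ))) * f v₂)))
          =O[Filter.atTop] fun ω : ℝ => (ω ^ (2 * N * (N + 1) + 2))⁻¹) ∧
        (Kissing.IsEvenFun f →
          (fun ω : ℝ => Kissing.symmIntegral (2 * N + 1) f ω -
            2 * (-1) ^ N / (ω : ℂ) ^ (2 * N * (N + 1) + 1) * Kissing.oddConst N *
              f v₁ * ((Real.sin ω : ℝ) : ℂ))
          =O[Filter.atTop] fun ω : ℝ => (ω ^ (2 * N * (N + 1) + 2))⁻¹)) ∧
    -- the resulting asymptotics of the Hankel determinant `h_{2N}`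
    ((fun ω : ℝ => Kissing.hankelDet (2 * N) ω -
        2 * (-1) ^ N / (ω : ℂ) ^ (2 * N * (N + 1) + 1) * Kissing.oddConst N *
          ((Real.sin ω : ℝ) : ℂ))
      =O[Filter.atTop] fun ω : ℝ => (ω ^ (2 * N * (N + 1) + 2))⁻¹) ∧
    -- `h_{2N}` vanishes approximately at (and, for large `ω`, only near) the multiples of `π`,
    -- and at its large zeros there is no monic orthogonal polynomial of degree `2N+1`
    (∃ C Ω : ℝ, 0 < C ∧ 0 < Ω ∧
      (∀ k : ℕ, Ω ≤ (k : ℝ) → ∃ ω : ℝ, |ω - k * Real.pi| ≤ C / k ∧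
        Kissing.hankelDet (2 * N) ω = 0 ∧ ¬ ∃ p, Kissing.IsMonicOP (2 * N + 1) ω p) ∧
      (∀ ω : ℝ, Ω ≤ ω → Kissing.hankelDet (2 * N) ω = 0 →
        (∃ k : ℕ, |ω - k * Real.pi| ≤ C / ω) ∧
          ¬ ∃ p, Kissing.IsMonicOP (2 * N + 1) ω p)) := by
  refine ⟨fun f hf hsym v₁ hv₁ v₂ hv₂ _ _ =>
    ⟨Kissing.symmIntegral_odd_isBigO hf hsym hv₁ hv₂,
      fun heven => Kissing.symmIntegral_odd_isBigO_of_even hf hsym heven hv₁⟩,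
    Kissing.hankelDet_isBigO N, ?_⟩
  obtain ⟨H, B, W, hH, hB, hHW⟩ := Kissing.exists_normalized_hankelDet N
  obtain ⟨W', hW'⟩ := Filter.eventually_atTop.1 (Kissing.eventually_hankelDet_odd_ne_zero N)
  -- `W` is for the sine approximation, `W'` for `h_{2N+1} ≠ 0`, `1` for positivity, and `2B` makes
  -- `δ = 2B/k` at most `1`.
  set Ω : ℝ := max (max W W') (max 1 (2 * B)) with hΩ
  have hΩW : W ≤ Ω := (le_max_left _ _).trans (le_max_left _ _)
  have hΩW' : W' ≤ Ω := (le_max_right _ _).trans (le_max_left _ _)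
  have hΩ1 : 1 ≤ Ω := (le_max_left _ _).trans (le_max_right _ _)
  have hΩB : 2 * B ≤ Ω := (le_max_right _ _).trans (le_max_right _ _)
  have hOP : ∀ ω : ℝ, Ω ≤ ω → Kissing.hankelDet (2 * N) ω = 0 →
      ¬ ∃ p, Kissing.IsMonicOP (2 * N + 1) ω p := fun ω hω h0 ⟨p, hp⟩ =>
    hW' ω (hΩW'.trans hω) (Kissing.hankelDet_succ_eq_zero h0 hp)
  refine ⟨2 * B, Ω, by positivity, by linarith, fun k hk => ?_, fun ω hω h0 => ⟨?_, hOP ω hω h0⟩⟩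
  · obtain ⟨ω, hkω, hω, hω0⟩ := Kissing.exists_zero_near_mul_pi hH hB
      (fun ω hω => (hHW ω hω).2) (hΩW.trans hk) (hΩ1.trans hk) (hΩB.trans hk)
    have h0 := (hHW ω (hΩW.trans (hk.trans hkω))).1.2 hω0
    exact ⟨ω, hω, h0, hOP ω (hk.trans hkω) h0⟩
  · obtain ⟨h1, h2⟩ := hHW ω (hΩW.trans hω)
    rw [h1.1 h0, zero_sub, abs_neg] at h2
    exact Kissing.exists_nat_mul_pi_near (by linarith) h2
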